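/- **Setting.** Let $\tau>0$, let $X$ be a complex Banach space and let $U_0,U_{d0},Y_0$ be complex Hilbert spaces. Consider the $\tau$-periodic system $$\dot x(t)=A(t)x(t)+B(t)u(t)+B_d(t)w_{dist}(t),\quad x(0)=x_0,\qquad y(t)=C(t)x(t)+D(t)u(t),$$ where $B,B_d,C,D$ are $\tau$-periodic, essentially bounded functions on $\mathbb R$ with values in $\mathcal L(U_0,X)$, $\mathcal L(U_{d0},X)$, $\mathcal L(X,Y_0)$, $\mathcal L(U_0,Y_0)$, and $A(\cdot)$ enters through a strongly continuous evolution family $U_A(t,s)\in\mathcal L(X)$, $t\ge s$, with $U_A(t,t)=I$, $U_A(t,r)U_A(r,s)=U_A(t,s)$ for $t\ge r\ge s$, and $U_A(t+\tau,s+\tau)=U_A(t,s)$. The state is the mild state $$x(t)=U_A(t,0)x_0+\int_0^tU_A(t,s)\big(B(s)u(s)+B_d(s)w_{dist}(s)\big)ds .$$ Put $U=L^2(0,\tau;U_0)$, $U_d=L^2(0,\tau;U_{d0})$, $Y=L^2(0,\tau;Y_0)$. The system is *exponentially stable* if $\|U_A(t,s)\|\le Me^{-\omega(t-s)}$ for all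 $t\ge s$ and some $M,\omega>0$; then $I-U_A(\tau,0)$ is boundedly invertible. With $G_A(t,s)=U_A(t,0)(I-U_A(\tau,0))^{-1}U_A(\tau,s)$, define $\mathcal P\in\mathcal L(U,Y)$ and $\mathcal P_d\in\mathcal L(U_d,Y)$ by $$\mathcal Pu=C(\cdot)\int_0^\tau G_A(\cdot,s)B(s)u(s)ds+C(\cdot)\int_0^{\cdot}U_A(\cdot,s)B(s)u(s)ds+D(\cdot)u(\cdot),$$ $$\mathcal P_dw=C(\cdot)\int_0^\tau G_A(\cdot,s)B_d(s)w(s)ds+C(\cdot)\int_0^{\cdot}U_A(\cdot,s)B_d(s)w(s)ds .$$ Let $y_{ref}\in L^2_{loc}(0,\infty;Y_0)$ and $w^1_{dist},\dots,w^q_{dist}\in L^2_{loc}(0,\infty;U_{d0})$ be known $\tau$-periodic functions, and let $w_{dist}=\sum_{k=1}^qv_kw^k_{dist}$ with an unknown coefficient vector $v=(v_1,\dots,v_q)\in\mathbb C^q$. A controller $(G_1,G_2,K)$ with $G_1\in\mathcal L(Z)$, $G_2\in\mathcal L(Y,Z)$, $K\in\mathcal L(Z,U)$ acts by $$u(n\tau+\cdot)=Kz_n\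 \text{ on }[0,\tau),\qquad z_{n+1}=G_1z_n+G_2\big(y(n\tau+\cdot)-y_{ref}(\cdot)\big),\qquad n\ge0,\ z_0\in Z .$$ It *solves the error feedback output regulation problem* if the closed loop has a trajectory for all initial states $x_0\in X$, $z_0\in Z$ and all $\tau$-periodic $L^2_{loc}$ references and disturbances, and if 1. (exponential closed-loop stability) there are $M_0,M_1,\alpha_0,\alpha_1>0$ such that for $y_{ref}\equiv0$, $w_{dist}\equiv0$ and all $x_0,z_0$: $\|x(t)\|\le M_0e^{-\alpha_0t}(\|x_0\|+\|z_0\|)$ for all $t\ge0$ and $\|z_n\|\le M_1e^{-\alpha_1n}(\|x_0\|+\|z_0\|)$ for all $n\ge0$; 2. (tracking) there are $M,\alpha>0$ such that for all $x_0\in X$, $z_0\in Z$, $v\in\mathbb C^q$ and $n\ge0$ $$\int_{n\tau}^{(n+1)\tau}\|y(t)-y_{ref}(t)\|^2dt\le M^2e^{-2\alpha n}\big(\|x_0\|^2+\|z_0\|^2+\|v\|^2+1\big).$$ **Theorem.** Assume that the system is exponentially stable and that $y_{ref}\not\equiv0$ or $w^k_{dist}\not\equiv0$ for some $k$. Assume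 that there are $u^0_{reg},\dots,u^q_{reg}\in U$ with $$\mathcal Pu^0_{reg}=y_{ref},\qquad \mathcal Pu^k_{reg}=\mathcal P_dw^k_{dist}\quad(1\le k\le q).$$ Let $k_1,\dots,k_r\in\{0,\dots,q\}$ be indices such that $\{u^{k_j}_{reg}\}_{j=1}^r$ is a basis of $\operatorname{span}\{u^0_{reg},\dots,u^q_{reg}\}$, and assume that $\mathcal Pu^{k_1}_{reg},\dots,\mathcal Pu^{k_r}_{reg}$ are linearly independent. Let $Z=\mathbb C^r$, let $Q\in\mathbb C^{r\times r}$ be invertible, let $K_0z=\sum_{j=1}^rz_ju^{k_j}_{reg}$ for $z\in\mathbb C^r$, and put $$G_1=I,\qquad G_2=-(\mathcal PK_0Q)^*,\qquad K=\varepsilon K_0Q .$$ Then there is $\varepsilon^*>0$ such that for every $0<\varepsilon\le\varepsilon^*$ the $r$-dimensional controller $(G_1,G_2,K)$ solves the error feedback output regulation problem. -/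

import Mathlib

open MeasureTheory Set Filter Topology
open scoped ENNReal

noncomputable section

/-- Lebesgue measure on one period `(0, τ]`. -/
abbrev periodMeasure (τ : ℝ) : Measure ℝ := volume.restrict (Ioc 0 τ)

/-- The space `L²(0, τ; E)`. -/
abbrev PeriodL2 (τ : ℝ) (E : Type*) [NormedAddCommGroup E] : Type _ :=
  Lp E 2 (periodMeasure τ)

/-- A `τ`-periodic function that is square integrable over a period; by periodicity this is the
same as a `τ`-periodic locally square integrable function. -/
structure IsPeriodicL2 {E : Type*} [NormedAddCommGroup E] (τ : ℝ) (f : ℝ → E) : Prop where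
  periodic : Function.Periodic f τ
  memLp : MemLp f 2 (periodMeasure τ)

/-- Essentially bounded (strongly measurable) operator-valued function. Measurability is only
required of every orbit `t ↦ T t x`, which is weaker than measurability in operator norm. -/
structure IsEssBddOp {E F : Type*} [NormedAddCommGroup E] [NormedSpace ℂ E]
    [NormedAddCommGroup F] [NormedSpace ℂ F] (T : ℝ → E →L[ℂ] F) : Prop where
  aesm : ∀ x : E, AEStronglyMeasurable (fun t => T t x) volume
  bdd : ∃ c : ℝ, ∀ᵐ t ∂(volume : Measure ℝ), ‖T t‖ ≤ c

/-- A strongly continuous evolution family `U(t,s)`, `t ≥ s`, on `X`. The values of `op t s` for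
`t < s` are irrelevant. -/
structure EvolutionFamily (X : Type*) [NormedAddCommGroup X] [NormedSpace ℂ X] where
  op : ℝ → ℝ → X →L[ℂ] X
  op_self : ∀ t, op t t = ContinuousLinearMap.id ℂ X
  op_comp : ∀ s r t, s ≤ r → r ≤ t → (op t r).comp (op r s) = op t s
  strong_cont : ∀ x, ContinuousOn (fun p : ℝ × ℝ => op p.1 p.2 x) {p | p.2 ≤ p.1}

/-- Exponential stability: `‖U(t,s)‖ ≤ M e^{-ω(t-s)}` for all `t ≥ s`, for some `M, ω > 0`. -/
def EvolutionFamily.IsExpStable {X : Type*} [NormedAddCommGroup X] [NormedSpace ℂ X]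
    (U : EvolutionFamily X) : Prop :=
  ∃ M ω : ℝ, 0 < M ∧ 0 < ω ∧ ∀ s t, s ≤ t → ‖U.op t s‖ ≤ M * Real.exp (-ω * (t - s))

/-- A `τ`-periodic linear system
`x'(t) = A(t)x(t) + B(t)u(t) + B_d(t)w(t)`, `y(t) = C(t)x(t) + D(t)u(t)`,
where `A` enters through its evolution family. -/
structure PeriodicSystem (τ : ℝ) (X U₀ Ud₀ Y₀ : Type*)
    [NormedAddCommGroup X] [NormedSpace ℂ X]
    [NormedAddCommGroup U₀] [NormedSpace ℂ U₀]
    [NormedAddCommGroup Ud₀] [NormedSpace ℂ Ud₀]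
    [NormedAddCommGroup Y₀] [NormedSpace ℂ Y₀] where
  evol : EvolutionFamily X
  B : ℝ → U₀ →L[ℂ] X
  Bd : ℝ → Ud₀ →L[ℂ] X
  C : ℝ → X →L[ℂ] Y₀
  D : ℝ → U₀ →L[ℂ] Y₀
  evol_periodic : ∀ s t, s ≤ t → evol.op (t + τ) (s + τ) = evol.op t s
  B_periodic : Function.Periodic B τ
  Bd_periodic : Function.Periodic Bd τ
  C_periodic : Function.Periodic C τ
  D_periodic : Function.Periodic D τ
  B_bdd : IsEssBddOp B
  Bd_bdd : IsEssBddOp Bd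
  C_bdd : IsEssBddOp C
  D_bdd : IsEssBddOp D

/-! ### Facts needed to see that the steady-state operators map `L²` boundedly to `L²` -/

section Aux

variable {E F X : Type*} [NormedAddCommGroup E] [NormedSpace ℂ E]
  [NormedAddCommGroup F] [NormedSpace ℂ F] [NormedAddCommGroup X] [NormedSpace ℂ X]

theorem aesm_op_apply {μ : Measure ℝ} {T : ℝ → E →L[ℂ] F} {f : ℝ → E}
    (hT : ∀ x, AEStronglyMeasurable (fun t => T t x) μ) (hf : AEStronglyMeasurable f μ) :
    AEStronglyMeasurable (fun t => T t (f t)) μ := by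
  have hsimple : ∀ g : SimpleFunc ℝ E, AEStronglyMeasurable (fun t => T t (g t)) μ := by
    intro g
    induction g using SimpleFunc.induction with
    | @const c s hs =>
      refine ((hT c).indicator hs).congr (Eventually.of_forall fun t => ?_)
      by_cases h : t ∈ s <;> simp [h]
    | @add g₁ g₂ _ h₁ h₂ =>
      refine (h₁.add h₂).congr (Eventually.of_forall fun t => ?_)
      simp
  obtain ⟨g, hg, hfg⟩ := hf
  have h1 : AEStronglyMeasurable (fun t => T t (g t)) μ :=
    aestronglyMeasurable_of_tendsto_ae atTop (fun n => hsimple (hg.approx n))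
      (Eventually.of_forall fun t => ((T t).continuous.tendsto _).comp (hg.tendsto_approx t))
  refine h1.congr ?_
  filter_upwards [hfg] with t ht
  rw [ht]

theorem IsEssBddOp.exists_bound {T : ℝ → E →L[ℂ] F} (hT : IsEssBddOp T) :
    ∃ c : ℝ, 0 ≤ c ∧ ∀ᵐ t ∂(volume : Measure ℝ), ‖T t‖ ≤ c := by
  obtain ⟨c, hc⟩ := hT.bdd
  exact ⟨max c 0, le_max_right _ _, hc.mono fun t ht => ht.trans (le_max_left _ _)⟩

theorem IsEssBddOp.memLp {T : ℝ → E →L[ℂ] F} (hT : IsEssBddOp T) {τ : ℝ} {p : ℝ≥0∞}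
    {f : ℝ → E} (hf : MemLp f p (periodMeasure τ)) :
    MemLp (fun t => T t (f t)) p (periodMeasure τ) := by
  obtain ⟨c, -, hc⟩ := hT.exists_bound
  refine hf.of_le_mul (c := c) (aesm_op_apply (fun x => (hT.aesm x).restrict) hf.1) ?_
  filter_upwards [ae_restrict_of_ae hc] with t ht
  exact (T t).le_of_opNorm_le ht _

theorem EvolutionFamily.exists_bound [CompleteSpace X] (U : EvolutionFamily X) (T : ℝ) :
    ∃ c : ℝ, 0 ≤ c ∧ ∀ s t, 0 ≤ s → s ≤ t → t ≤ T → ‖U.op t s‖ ≤ c := by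
  let K : Set (ℝ × ℝ) := (Icc 0 T ×ˢ Icc 0 T) ∩ {p | p.2 ≤ p.1}
  have hK : IsCompact K :=
    (isCompact_Icc.prod isCompact_Icc).inter_right (isClosed_le continuous_snd continuous_fst)
  obtain ⟨c, hc⟩ := banach_steinhaus (g := fun p : K => U.op p.1.1 p.1.2) (fun x => by
    obtain ⟨c, hc⟩ := hK.exists_bound_of_continuousOn
      ((U.strong_cont x).mono inter_subset_right)
    exact ⟨c, fun p => hc p.1 p.2⟩)
  refine ⟨max c 0, le_max_right _ _, fun s t h0 hst htT => (hc ⟨(t, s), ?_⟩).trans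
    (le_max_left _ _)⟩
  exact ⟨⟨⟨h0.trans hst, htT⟩, ⟨h0, hst.trans htT⟩⟩, hst⟩

theorem EvolutionFamily.aesm_right (U : EvolutionFamily X) (t : ℝ) {f : ℝ → X}
    (hf : AEStronglyMeasurable f (periodMeasure t)) :
    AEStronglyMeasurable (fun s => U.op t s (f s)) (periodMeasure t) := by
  refine aesm_op_apply (fun x => ?_) hf
  refine ContinuousOn.aestronglyMeasurable ?_ measurableSet_Ioc
  exact (U.strong_cont x).comp (f := fun s => (t, s)) (by fun_prop) fun s hs => hs.2

theorem EvolutionFamily.integrable_right [CompleteSpace X] (U : EvolutionFamily X) (t : ℝ)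
    {f : ℝ → X} (hf : Integrable f (periodMeasure t)) :
    Integrable (fun s => U.op t s (f s)) (periodMeasure t) := by
  obtain ⟨c, -, hc⟩ := U.exists_bound t
  refine (hf.norm.const_mul c).mono' (U.aesm_right t hf.1) ?_
  filter_upwards [ae_restrict_mem measurableSet_Ioc] with s hs
  exact (U.op t s).le_of_opNorm_le (hc s t hs.1.le hs.2 le_rfl) _

theorem EvolutionFamily.continuousOn_left (U : EvolutionFamily X) (s : ℝ) (x : X) :
    ContinuousOn (fun t => U.op t s x) (Ici s) :=
  (U.strong_cont x).comp (f := fun t => (t, s)) (by fun_prop) fun _ ht => ht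

theorem EvolutionFamily.continuousOn_integral [CompleteSpace X] (U : EvolutionFamily X)
    {τ : ℝ} {f : ℝ → X} (hf : Integrable f (periodMeasure τ)) :
    ContinuousOn (fun t => ∫ s in (0 : ℝ)..t, U.op t s (f s)) (Ioc 0 τ) := by
  obtain ⟨c, hc0, hc⟩ := U.exists_bound τ
  have key : ∀ t ∈ Ioc 0 τ, ∫ s in (0 : ℝ)..t, U.op t s (f s)
      = ∫ s, (Iic t).indicator (fun s => U.op t s (f s)) s ∂(periodMeasure τ) := by
    intro t ht
    rw [intervalIntegral.integral_of_le ht.1.le, integral_indicator measurableSet_Iic,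
      Measure.restrict_restrict measurableSet_Iic]
    congr 2
    ext s
    simp only [mem_Ioc, mem_inter_iff, mem_Iic]
    exact ⟨fun h => ⟨h.2, h.1, h.2.trans ht.2⟩, fun h => ⟨h.2.1, h.1⟩⟩
  refine ContinuousOn.congr (fun t₀ ht₀ => ?_) key
  refine continuousWithinAt_of_dominated (bound := fun s => c * ‖f s‖) ?_ ?_
    (hf.norm.const_mul c) ?_
  · filter_upwards [self_mem_nhdsWithin] with t ht
    rw [aestronglyMeasurable_indicator_iff measurableSet_Iic,
      Measure.restrict_restrict measurableSet_Iic]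
    have hset : Iic t ∩ Ioc 0 τ = Ioc 0 t := by
      ext s
      simp only [mem_Ioc, mem_inter_iff, mem_Iic]
      exact ⟨fun h => ⟨h.2.1, h.1⟩, fun h => ⟨h.2, h.1, h.2.trans ht.2⟩⟩
    rw [hset]
    exact U.aesm_right t (hf.1.mono_measure (Measure.restrict_mono (Ioc_subset_Ioc_right ht.2)
      le_rfl))
  · filter_upwards [self_mem_nhdsWithin] with t ht
    filter_upwards [ae_restrict_mem measurableSet_Ioc] with s hs
    by_cases h : s ≤ t
    · rw [indicator_of_mem (mem_Iic.2 h)]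
      exact (U.op t s).le_of_opNorm_le (hc s t hs.1.le h ht.2) _
    · rw [indicator_of_notMem (by simpa using h), norm_zero]
      positivity
  · have hne : ∀ᵐ s ∂(periodMeasure τ), s ≠ t₀ := by
      refine ae_restrict_of_ae ?_
      simp [ae_iff]
    filter_upwards [hne] with s hs
    rcases lt_or_gt_of_ne hs with h | h
    · have h1 : ContinuousWithinAt (fun t => U.op t s (f s)) (Ioc 0 τ) t₀ :=
        ((U.continuousOn_left s (f s)).continuousAt (Ici_mem_nhds h)).continuousWithinAt
      refine h1.congr_of_eventuallyEq ?_ (by simp [h.le])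
      filter_upwards [mem_nhdsWithin_of_mem_nhds (Ioi_mem_nhds h)] with t ht
      simp [le_of_lt (mem_Ioi.1 ht)]
    · refine (continuousWithinAt_const (b := (0 : X))).congr_of_eventuallyEq ?_ (by simp [h])
      filter_upwards [mem_nhdsWithin_of_mem_nhds (Iio_mem_nhds h)] with t ht
      simp [mem_Iio.1 ht]

end Aux

theorem integral_norm_le_L2 {E : Type*} [NormedAddCommGroup E] (τ : ℝ) :
    ∃ c : ℝ, 0 ≤ c ∧ ∀ f : PeriodL2 τ E, ∫ t, ‖f t‖ ∂(periodMeasure τ) ≤ c * ‖f‖ := by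
  refine ⟨((periodMeasure τ) univ ^ (1 / (1 : ℝ≥0∞).toReal - 1 / (2 : ℝ≥0∞).toReal)).toReal,
    ENNReal.toReal_nonneg, fun f => ?_⟩
  have h := eLpNorm_le_eLpNorm_mul_rpow_measure_univ (μ := periodMeasure τ) (p := 1) (q := 2)
    (by norm_num) (Lp.aestronglyMeasurable f)
  have hfin : eLpNorm f 2 (periodMeasure τ) *
      (periodMeasure τ) univ ^ (1 / (1 : ℝ≥0∞).toReal - 1 / (2 : ℝ≥0∞).toReal) ≠ ∞ := by
    refine ENNReal.mul_ne_top (Lp.eLpNorm_ne_top f) (ENNReal.rpow_ne_top_of_nonneg ?_ ?_)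
    · norm_num
    · exact measure_ne_top _ _
  rw [integral_norm_eq_lintegral_enorm (Lp.aestronglyMeasurable f), ← eLpNorm_one_eq_lintegral_enorm,
    Lp.norm_def, mul_comm, ← ENNReal.toReal_mul]
  exact ENNReal.toReal_mono hfin h


/-- Multiplication by an essentially bounded operator-valued function on `L²(0,τ)`. -/
def mulOp (τ : ℝ) {E F : Type*} [NormedAddCommGroup E] [NormedSpace ℂ E]
    [NormedAddCommGroup F] [NormedSpace ℂ F] (D : ℝ → E →L[ℂ] F) (hD : IsEssBddOp D) :
    PeriodL2 τ E →L[ℂ] PeriodL2 τ F :=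
  LinearMap.mkContinuousOfExistsBound
    { toFun := fun v => (hD.memLp (Lp.memLp v)).toLp fun t => D t (v t)
      map_add' := fun v w => by
        rw [← MemLp.toLp_add]
        refine MemLp.toLp_congr _ _ ?_
        filter_upwards [Lp.coeFn_add v w] with s hs
        simp only [Pi.add_apply] at hs ⊢
        rw [hs, map_add]
      map_smul' := fun c v => by
        rw [RingHom.id_apply, ← MemLp.toLp_const_smul]
        refine MemLp.toLp_congr _ _ ?_
        filter_upwards [Lp.coeFn_smul c v] with s hs
        simp only [Pi.smul_apply] at hs ⊢
        rw [hs, map_smul] }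
    (by
      obtain ⟨b, hb0, hb⟩ := hD.exists_bound
      refine ⟨b, fun v => Lp.norm_le_mul_norm_of_ae_le_mul ?_⟩
      filter_upwards [ae_restrict_of_ae hb, (hD.memLp (Lp.memLp v)).coeFn_toLp] with t ht ht'
      simp only [LinearMap.coe_mk, AddHom.coe_mk]
      rw [ht']
      exact (D t).le_of_opNorm_le ht _)

namespace PeriodicSystem

variable {τ : ℝ} {X U₀ Ud₀ Y₀ : Type*}
  [NormedAddCommGroup X] [NormedSpace ℂ X]
  [NormedAddCommGroup U₀] [NormedSpace ℂ U₀]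
  [NormedAddCommGroup Ud₀] [NormedSpace ℂ Ud₀]
  [NormedAddCommGroup Y₀] [NormedSpace ℂ Y₀]
  {V : Type*} [NormedAddCommGroup V] [NormedSpace ℂ V]

/-- If the system is exponentially stable, then `I - U(τ,0)` is boundedly invertible. -/
theorem isUnit_one_sub [CompleteSpace X] (S : PeriodicSystem τ X U₀ Ud₀ Y₀) (hτ : 0 < τ)
    (hS : S.evol.IsExpStable) : IsUnit (1 - S.evol.op τ 0) := by
  obtain ⟨M, ω, hM, hω, h⟩ := hS
  have hper : ∀ n : ℕ, S.evol.op ((n : ℝ) * τ + τ) ((n : ℝ) * τ) = S.evol.op τ 0 := by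
    intro n
    induction n with
    | zero => simp
    | succ n ih =>
      rw [← ih, ← S.evol_periodic ((n : ℝ) * τ) ((n : ℝ) * τ + τ) (by linarith)]
      push_cast
      ring_nf
  have hpow : ∀ n : ℕ, S.evol.op τ 0 ^ n = S.evol.op ((n : ℝ) * τ) 0 := by
    intro n
    induction n with
    | zero => simp [S.evol.op_self, ContinuousLinearMap.one_def]
    | succ n ih =>
      have hn : 0 ≤ (n : ℝ) * τ := by positivity
      rw [pow_succ', ih, ← hper n, ContinuousLinearMap.mul_def,
        S.evol.op_comp 0 ((n : ℝ) * τ) ((n : ℝ) * τ + τ) hn (by linarith)]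
      push_cast
      ring_nf
  have hlim : Tendsto (fun n : ℕ => M * Real.exp (-ω * τ) ^ n) atTop (𝓝 (M * 0)) :=
    (tendsto_pow_atTop_nhds_zero_of_lt_one (Real.exp_pos _).le
      (Real.exp_lt_one_iff.2 (by nlinarith))).const_mul M
  rw [mul_zero] at hlim
  obtain ⟨n, hn⟩ := (hlim.eventually (gt_mem_nhds one_pos)).exists
  have hlt : ‖S.evol.op τ 0 ^ n‖ < 1 := by
    rw [hpow]
    refine (h 0 ((n : ℝ) * τ) (by positivity)).trans_lt ?_
    rw [← Real.exp_nat_mul] at hn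
    convert hn using 3
    ring
  have hu : IsUnit (1 - S.evol.op τ 0 ^ n) := isUnit_one_sub_of_norm_lt_one hlt
  have hcomm : Commute (1 - S.evol.op τ 0) (∑ i ∈ Finset.range n, S.evol.op τ 0 ^ i) :=
    Commute.sum_right _ _ _ fun i _ =>
      ((Commute.one_left _).sub_left (Commute.pow_right (Commute.refl _) i))
  rw [← mul_neg_geom_sum] at hu
  exact (hcomm.isUnit_mul_iff.1 hu).1

/-- The kernel `G_A(t,s) = U(t,0) (I - U(τ,0))⁻¹ U(τ,s)`. For an exponentially stable system
`I - U(τ,0)` is boundedly invertible (`isUnit_one_sub`), and `Ring.inverse` is its inverse. -/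
def green (S : PeriodicSystem τ X U₀ Ud₀ Y₀) (t s : ℝ) : X →L[ℂ] X :=
  (S.evol.op t 0).comp ((Ring.inverse (1 - S.evol.op τ 0)).comp (S.evol.op τ s))

/-- The function `C(·) ∫₀^τ G_A(·,s) f(s) ds + C(·) ∫₀^· U(·,s) f(s) ds`. -/
def steadyFun (S : PeriodicSystem τ X U₀ Ud₀ Y₀) (f : ℝ → X) (t : ℝ) : Y₀ :=
  S.C t (∫ s in (0 : ℝ)..τ, S.green t s (f s)) + S.C t (∫ s in (0 : ℝ)..t, S.evol.op t s (f s))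

theorem integrable_green [CompleteSpace X] (S : PeriodicSystem τ X U₀ Ud₀ Y₀) (t : ℝ)
    {f : ℝ → X} (hf : Integrable f (periodMeasure τ)) :
    Integrable (fun s => S.green t s (f s)) (periodMeasure τ) :=
  ((S.evol.op t 0).comp (Ring.inverse (1 - S.evol.op τ 0))).integrable_comp
    (S.evol.integrable_right τ hf)

theorem integral_green [CompleteSpace X] (S : PeriodicSystem τ X U₀ Ud₀ Y₀) (t : ℝ)
    {f : ℝ → X} (hf : Integrable f (periodMeasure τ)) :
    ∫ s, S.green t s (f s) ∂(periodMeasure τ) =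
      S.evol.op t 0 (Ring.inverse (1 - S.evol.op τ 0)
        (∫ s, S.evol.op τ s (f s) ∂(periodMeasure τ))) :=
  ((S.evol.op t 0).comp (Ring.inverse (1 - S.evol.op τ 0))).integral_comp_comm
    (S.evol.integrable_right τ hf)

theorem aesm_steadyFun [CompleteSpace X] (S : PeriodicSystem τ X U₀ Ud₀ Y₀)
    {f : ℝ → X} (hf : Integrable f (periodMeasure τ)) :
    AEStronglyMeasurable (S.steadyFun f) (periodMeasure τ) := by
  have hC : ∀ x, AEStronglyMeasurable (fun t => S.C t x) (periodMeasure τ) :=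
    fun x => (S.C_bdd.aesm x).restrict
  refine (aesm_op_apply hC ?_).add (aesm_op_apply hC ?_)
  · refine ContinuousOn.aestronglyMeasurable ?_ measurableSet_Ioc
    refine ContinuousOn.congr (f := fun t => S.evol.op t 0 (Ring.inverse (1 - S.evol.op τ 0)
        (∫ s, S.evol.op τ s (f s) ∂(periodMeasure τ))))
      ((S.evol.continuousOn_left 0 _).mono fun t ht => ht.1.le) fun t ht => ?_
    simp only
    rw [intervalIntegral.integral_of_le (ht.1.le.trans ht.2), S.integral_green t hf]
  · exact (S.evol.continuousOn_integral hf).aestronglyMeasurable measurableSet_Ioc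

theorem exists_bound_steadyFun [CompleteSpace X] (S : PeriodicSystem τ X U₀ Ud₀ Y₀) :
    ∃ c : ℝ, 0 ≤ c ∧ ∀ f : ℝ → X, Integrable f (periodMeasure τ) →
      ∀ᵐ t ∂(periodMeasure τ), ‖S.steadyFun f t‖ ≤ c * ∫ s, ‖f s‖ ∂(periodMeasure τ) := by
  obtain ⟨a, ha0, ha⟩ := S.evol.exists_bound τ
  obtain ⟨c, hc0, hc⟩ := S.C_bdd.exists_bound
  let R := Ring.inverse (1 - S.evol.op τ 0)
  have hconv : ∀ f : ℝ → X, Integrable f (periodMeasure τ) → ∀ t ∈ Ioc 0 τ,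
      ‖∫ s in (0 : ℝ)..t, S.evol.op t s (f s)‖ ≤ a * ∫ s, ‖f s‖ ∂(periodMeasure τ) := by
    intro f hf t ht
    have hsub : periodMeasure t ≤ periodMeasure τ :=
      Measure.restrict_mono (Ioc_subset_Ioc_right ht.2) le_rfl
    rw [intervalIntegral.integral_of_le ht.1.le]
    refine (norm_integral_le_of_norm_le (g := fun s => a * ‖f s‖)
      ((hf.mono_measure hsub).norm.const_mul a) ?_).trans ?_
    · filter_upwards [ae_restrict_mem measurableSet_Ioc] with s hs
      exact (S.evol.op t s).le_of_opNorm_le (ha s t hs.1.le hs.2 ht.2) _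
    · rw [integral_const_mul]
      exact mul_le_mul_of_nonneg_left (integral_mono_measure hsub
        (Eventually.of_forall fun s => norm_nonneg _) hf.norm) ha0
  refine ⟨c * (a * ‖R‖ * a + a), by positivity, fun f hf => ?_⟩
  filter_upwards [ae_restrict_of_ae hc, ae_restrict_mem measurableSet_Ioc] with t hCt ht
  have hτ : 0 < τ := ht.1.trans_le ht.2
  set I := ∫ s, ‖f s‖ ∂(periodMeasure τ) with hI
  have hI0 : 0 ≤ I := integral_nonneg fun s => norm_nonneg _
  have h1 : ‖∫ s in (0 : ℝ)..τ, S.green t s (f s)‖ ≤ a * ‖R‖ * a * I := by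
    rw [intervalIntegral.integral_of_le hτ.le, S.integral_green t hf,
      ← intervalIntegral.integral_of_le hτ.le]
    have h2 := hconv f hf τ ⟨hτ, le_rfl⟩
    calc _ ≤ a * (‖R‖ * (a * I)) :=
          (S.evol.op t 0).le_of_opNorm_le_of_le (ha 0 t le_rfl ht.1.le ht.2)
            (R.le_of_opNorm_le_of_le le_rfl h2)
      _ = _ := by ring
  have h2 := hconv f hf t ht
  calc ‖S.steadyFun f t‖ ≤ c * (a * ‖R‖ * a * I) + c * (a * I) :=
        (norm_add_le _ _).trans (add_le_add ((S.C t).le_of_opNorm_le_of_le hCt h1)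
          ((S.C t).le_of_opNorm_le_of_le hCt h2))
    _ = _ := by ring

theorem memLp_steadyFun [CompleteSpace X] (S : PeriodicSystem τ X U₀ Ud₀ Y₀)
    {f : ℝ → X} (hf : Integrable f (periodMeasure τ)) :
    MemLp (S.steadyFun f) 2 (periodMeasure τ) := by
  obtain ⟨c, -, hc⟩ := S.exists_bound_steadyFun
  exact MemLp.of_bound (S.aesm_steadyFun hf) _ (hc f hf)

theorem steadyFun_congr (S : PeriodicSystem τ X U₀ Ud₀ Y₀) {f g : ℝ → X}
    (h : f =ᵐ[periodMeasure τ] g) {t : ℝ} (ht : t ∈ Ioc 0 τ) :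
    S.steadyFun f t = S.steadyFun g t := by
  unfold steadyFun
  rw [intervalIntegral.integral_of_le (ht.1.le.trans ht.2),
    intervalIntegral.integral_of_le (ht.1.le.trans ht.2),
    intervalIntegral.integral_of_le ht.1.le, intervalIntegral.integral_of_le ht.1.le]
  congr 2
  · refine integral_congr_ae ?_
    filter_upwards [h] with s hs
    rw [hs]
  · refine integral_congr_ae ?_
    filter_upwards [ae_mono (Measure.restrict_mono (Ioc_subset_Ioc_right ht.2) le_rfl) h]
      with s hs
    rw [hs]

theorem steadyFun_add [CompleteSpace X] (S : PeriodicSystem τ X U₀ Ud₀ Y₀) {f g : ℝ → X}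
    (hf : Integrable f (periodMeasure τ)) (hg : Integrable g (periodMeasure τ))
    {t : ℝ} (ht : t ∈ Ioc 0 τ) :
    S.steadyFun (fun s => f s + g s) t = S.steadyFun f t + S.steadyFun g t := by
  have hsub : periodMeasure t ≤ periodMeasure τ :=
    Measure.restrict_mono (Ioc_subset_Ioc_right ht.2) le_rfl
  simp only [steadyFun, intervalIntegral.integral_of_le (ht.1.le.trans ht.2),
    intervalIntegral.integral_of_le ht.1.le, map_add]
  rw [integral_add (S.integrable_green t hf) (S.integrable_green t hg),
    integral_add (S.evol.integrable_right t (hf.mono_measure hsub))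
      (S.evol.integrable_right t (hg.mono_measure hsub)), map_add, map_add]
  abel

theorem steadyFun_smul (S : PeriodicSystem τ X U₀ Ud₀ Y₀) (c : ℂ) (f : ℝ → X) (t : ℝ) :
    S.steadyFun (fun s => c • f s) t = c • S.steadyFun f t := by
  simp only [steadyFun, map_smul, intervalIntegral.integral_smul, smul_add]

/-- For an essentially bounded `B`, the bounded operator
`v ↦ C(·) ∫₀^τ G_A(·,s) B(s) v(s) ds + C(·) ∫₀^· U(·,s) B(s) v(s) ds` from `L²(0,τ;V)`
to `L²(0,τ;Y₀)`. -/
def steadyOp [CompleteSpace X] (S : PeriodicSystem τ X U₀ Ud₀ Y₀) (B : ℝ → V →L[ℂ] X)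
    (hB : IsEssBddOp B) : PeriodL2 τ V →L[ℂ] PeriodL2 τ Y₀ :=
  have hint : ∀ v : PeriodL2 τ V, Integrable (fun s => B s (v s)) (periodMeasure τ) :=
    fun v => (hB.memLp (Lp.memLp v)).integrable (by norm_num)
  LinearMap.mkContinuousOfExistsBound
    { toFun := fun v => (S.memLp_steadyFun (hint v)).toLp (S.steadyFun fun s => B s (v s))
      map_add' := fun v w => by
        rw [← MemLp.toLp_add]
        refine MemLp.toLp_congr _ _ ?_
        filter_upwards [ae_restrict_mem measurableSet_Ioc] with t ht
        rw [Pi.add_apply, ← S.steadyFun_add (hint v) (hint w) ht]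
        refine S.steadyFun_congr ?_ ht
        filter_upwards [Lp.coeFn_add v w] with s hs
        simp only [Pi.add_apply] at hs ⊢
        rw [hs, map_add]
      map_smul' := fun c v => by
        rw [RingHom.id_apply, ← MemLp.toLp_const_smul]
        refine MemLp.toLp_congr _ _ ?_
        filter_upwards [ae_restrict_mem measurableSet_Ioc] with t ht
        rw [Pi.smul_apply, ← S.steadyFun_smul c]
        refine S.steadyFun_congr ?_ ht
        filter_upwards [Lp.coeFn_smul c v] with s hs
        simp only [Pi.smul_apply] at hs ⊢
        rw [hs, map_smul] }
    (by
      obtain ⟨c, hc0, hc⟩ := S.exists_bound_steadyFun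
      obtain ⟨b, hb0, hb⟩ := hB.exists_bound
      obtain ⟨l, hl0, hl⟩ := integral_norm_le_L2 (E := V) τ
      refine ⟨measureUnivNNReal (periodMeasure τ) ^ (2 : ℝ≥0∞).toReal⁻¹ * (c * (b * l)),
        fun v => ?_⟩
      have h1 : ∫ s, ‖B s (v s)‖ ∂(periodMeasure τ) ≤ b * (l * ‖v‖) := by
        refine le_trans ?_ (mul_le_mul_of_nonneg_left (hl v) hb0)
        rw [← integral_const_mul]
        refine integral_mono_ae (hint v).norm
          (((Lp.memLp v).integrable (by norm_num)).norm.const_mul b) ?_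
        filter_upwards [ae_restrict_of_ae hb] with s hs
        exact (B s).le_of_opNorm_le hs _
      refine (Lp.norm_le_of_ae_bound (C := c * (b * (l * ‖v‖))) (by positivity) ?_).trans
        (le_of_eq (by ring))
      filter_upwards [hc _ (hint v), (S.memLp_steadyFun (hint v)).coeFn_toLp] with t ht ht'
      simp only [LinearMap.coe_mk, AddHom.coe_mk]
      rw [ht']
      exact ht.trans (mul_le_mul_of_nonneg_left h1 hc0))

/-- The operator `𝒫 : L²(0,τ;U₀) → L²(0,τ;Y₀)`,
`𝒫u = C(·) ∫₀^τ G_A(·,s) B(s) u(s) ds + C(·) ∫₀^· U(·,s) B(s) u(s) ds + D(·) u(·)`. -/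
def P [CompleteSpace X] (S : PeriodicSystem τ X U₀ Ud₀ Y₀) :
    PeriodL2 τ U₀ →L[ℂ] PeriodL2 τ Y₀ :=
  S.steadyOp S.B S.B_bdd + mulOp τ S.D S.D_bdd

/-- The operator `𝒫_d : L²(0,τ;U_{d0}) → L²(0,τ;Y₀)`,
`𝒫_d w = C(·) ∫₀^τ G_A(·,s) B_d(s) w(s) ds + C(·) ∫₀^· U(·,s) B_d(s) w(s) ds`. -/
def Pd [CompleteSpace X] (S : PeriodicSystem τ X U₀ Ud₀ Y₀) :
    PeriodL2 τ Ud₀ →L[ℂ] PeriodL2 τ Y₀ :=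
  S.steadyOp S.Bd S.Bd_bdd

end PeriodicSystem

/-- The parameters `(G₁, G₂, K)` of a discrete-time dynamic error feedback controller
`z_{n+1} = G₁ z_n + G₂ (y(nτ + ·) - y_ref(·))`, `u(nτ + ·) = K z_n` on `[0, τ)`, with state
space `Z`. -/
structure FeedbackController (τ : ℝ) (U₀ Y₀ Z : Type*)
    [NormedAddCommGroup U₀] [NormedSpace ℂ U₀] [NormedAddCommGroup Y₀] [NormedSpace ℂ Y₀]
    [NormedAddCommGroup Z] [NormedSpace ℂ Z] where
  G₁ : Z →L[ℂ] Z
  G₂ : PeriodL2 τ Y₀ →L[ℂ] Z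
  K : Z →L[ℂ] PeriodL2 τ U₀

section ClosedLoop

variable {τ : ℝ} {X U₀ Ud₀ Y₀ Z : Type*}
  [NormedAddCommGroup X] [NormedSpace ℂ X]
  [NormedAddCommGroup U₀] [NormedSpace ℂ U₀]
  [NormedAddCommGroup Ud₀] [NormedSpace ℂ Ud₀]
  [NormedAddCommGroup Y₀] [NormedSpace ℂ Y₀]
  [NormedAddCommGroup Z] [NormedSpace ℂ Z]

/-- `(x, u, y, z)` is a trajectory of the closed-loop system on `t ≥ 0` with initial states
`x₀`, `z₀`, reference `y_ref` and disturbance `w`; the plant equation is in mild form. -/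
structure IsClosedLoopTrajectory (S : PeriodicSystem τ X U₀ Ud₀ Y₀)
    (ctrl : FeedbackController τ U₀ Y₀ Z) (yref : ℝ → Y₀) (w : ℝ → Ud₀) (x₀ : X) (z₀ : Z)
    (x : ℝ → X) (u : ℝ → U₀) (y : ℝ → Y₀) (z : ℕ → Z) : Prop where
  state : ∀ t, 0 ≤ t → x t = S.evol.op t 0 x₀
    + ∫ s in (0 : ℝ)..t, S.evol.op t s (S.B s (u s) + S.Bd s (w s))
  output : ∀ t, 0 ≤ t → y t = S.C t (x t) + S.D t (u t)
  input : ∀ n : ℕ, (fun s => u ((n : ℝ) * τ + s)) =ᵐ[periodMeasure τ] ctrl.K (z n)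
  ctrl_zero : z 0 = z₀
  ctrl_succ : ∀ n : ℕ, ∃ e : PeriodL2 τ Y₀,
    e =ᵐ[periodMeasure τ] (fun s => y ((n : ℝ) * τ + s) - yref s) ∧
      z (n + 1) = ctrl.G₁ (z n) + ctrl.G₂ e

/-- Exponential closed-loop stability: exponential decay of all trajectories with zero reference
and zero disturbance. -/
def IsExpStableClosedLoop (S : PeriodicSystem τ X U₀ Ud₀ Y₀)
    (ctrl : FeedbackController τ U₀ Y₀ Z) : Prop :=
  ∃ M₀ M₁ α₀ α₁ : ℝ, 0 < M₀ ∧ 0 < M₁ ∧ 0 < α₀ ∧ 0 < α₁ ∧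
    ∀ (x₀ : X) (z₀ : Z) (x : ℝ → X) (u : ℝ → U₀) (y : ℝ → Y₀) (z : ℕ → Z),
      IsClosedLoopTrajectory S ctrl (fun _ => 0) (fun _ => 0) x₀ z₀ x u y z →
        (∀ t, 0 ≤ t → ‖x t‖ ≤ M₀ * Real.exp (-α₀ * t) * (‖x₀‖ + ‖z₀‖)) ∧
        ∀ n : ℕ, ‖z n‖ ≤ M₁ * Real.exp (-α₁ * n) * (‖x₀‖ + ‖z₀‖)

/-- The controller solves the error feedback output regulation problem for the reference `yref`
and the disturbances `∑ k, v k • w k` with arbitrary coefficients `v ∈ ℂ^q`. The first field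
says that the closed loop does have a trajectory for all data. -/
structure SolvesErrorFeedbackORP {q : ℕ} (S : PeriodicSystem τ X U₀ Ud₀ Y₀)
    (ctrl : FeedbackController τ U₀ Y₀ Z) (yref : ℝ → Y₀) (w : Fin q → ℝ → Ud₀) : Prop where
  wellPosed : ∀ (r : ℝ → Y₀) (d : ℝ → Ud₀), IsPeriodicL2 τ r → IsPeriodicL2 τ d →
    ∀ (x₀ : X) (z₀ : Z), ∃ x u y z, IsClosedLoopTrajectory S ctrl r d x₀ z₀ x u y z
  stable : IsExpStableClosedLoop S ctrl
  tracking : ∃ M α : ℝ, 0 < M ∧ 0 < α ∧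
    ∀ (x₀ : X) (z₀ : Z) (v : EuclideanSpace ℂ (Fin q))
      (x : ℝ → X) (u : ℝ → U₀) (y : ℝ → Y₀) (z : ℕ → Z),
      IsClosedLoopTrajectory S ctrl yref (fun t => ∑ k, v k • w k t) x₀ z₀ x u y z →
        ∀ n : ℕ,
          IntervalIntegrable (fun t => ‖y t - yref t‖ ^ 2) volume
            ((n : ℝ) * τ) (((n : ℝ) + 1) * τ) ∧
          ∫ t in ((n : ℝ) * τ)..(((n : ℝ) + 1) * τ), ‖y t - yref t‖ ^ 2
            ≤ M ^ 2 * Real.exp (-2 * α * n) * (‖x₀‖ ^ 2 + ‖z₀‖ ^ 2 + ‖v‖ ^ 2 + 1)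

end ClosedLoop

section Design

variable {τ : ℝ} {X U₀ Ud₀ Y₀ : Type*}
  [NormedAddCommGroup X] [NormedSpace ℂ X] [CompleteSpace X]
  [NormedAddCommGroup U₀] [NormedSpace ℂ U₀]
  [NormedAddCommGroup Ud₀] [NormedSpace ℂ Ud₀]
  [NormedAddCommGroup Y₀] [InnerProductSpace ℂ Y₀] [CompleteSpace Y₀]

/-- The operator `K₀ z = ∑ j, z_j u_j` from `ℂ^r` to `L²(0,τ;U₀)`. -/
def synthesisOp {r : ℕ} (u : Fin r → PeriodL2 τ U₀) :
    EuclideanSpace ℂ (Fin r) →L[ℂ] PeriodL2 τ U₀ :=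
  ∑ j, (EuclideanSpace.proj j : EuclideanSpace ℂ (Fin r) →L[ℂ] ℂ).smulRight (u j)

/-- The `r`-dimensional controller `G₁ = I`, `G₂ = -(𝒫 K₀ Q)^*`, `K = ε K₀ Q`. -/
def regulatorController {r : ℕ} (S : PeriodicSystem τ X U₀ Ud₀ Y₀)
    (u : Fin r → PeriodL2 τ U₀) (Q : Matrix (Fin r) (Fin r) ℂ) (ε : ℝ) :
    FeedbackController τ U₀ Y₀ (EuclideanSpace ℂ (Fin r)) where
  G₁ := ContinuousLinearMap.id ℂ _
  G₂ := -ContinuousLinearMap.adjoint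
    (S.P.comp ((synthesisOp u).comp (Matrix.toEuclideanCLM (𝕜 := ℂ) Q)))
  K := (ε : ℂ) • (synthesisOp u).comp (Matrix.toEuclideanCLM (𝕜 := ℂ) Q)

end Design

end

/-! Sampling at the times `nτ` turns the closed loop into a discrete-time system. Let `Φ = U(τ,0)`,
let `R = (I - Φ)⁻¹`, and let `g_n` be the state reached from zero over one period under the n-th
input and the disturbance. The sampled state satisfies `x_{n+1} = Φ x_n + g_n`, and `R g_n` is the
initial state of the periodic solution for that input held fixed. The output on the n-th period is
therefore the output of this periodic solution, which `𝒫` and `𝒫_d` compute, plus the free response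
of the plant to the deviation `ξ_n = x_n - R g_n` (`IsPlantTrajectory.output_ae_eq`).

Write `L = K₀ Q` and `T = 𝒫 L`. Independence of the `𝒫 u^{k_j}` and invertibility of `Q` make `T`
injective. The span hypothesis puts every required input in the range of `L`, so some `z_s`
satisfies `𝒫 L z_s + 𝒫_d d = y_ref`. With `ζ_n = z_n - z_s/ε` the error is `e_n = C U ξ_n + ε T
ζ_n`, where `C U` is the observation map. All exogenous terms cancel: `ξ_{n+1} = Φ ξ_n + ε E e_n`
and `ζ_{n+1} = ζ_n - T^* e_n`, with `E` bounded and independent of `ε`.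

This is a slow integrator driven by a fast stable system. `Φ` contracts in an equivalent norm,
uniformly in `ε`. `I - ε T^*T` contracts at rate `1 - εκ`, because `T` is injective on a
finite-dimensional space and hence bounded below. The coupling from `ξ` to `ζ` is of order one but
is absorbed by weighting `ξ` heavily; the coupling back is of order `ε²` and is beaten by `εκ`. This
is `exists_gain_bound`. Decay of `ξ`, `ζ` and `e` gives both closed-loop stability (zero data) and
tracking. -/

section DiscreteStability

/-! ### Small-gain stability of a slow discrete integrator coupled to a power stable system. -/

variable {X W Y : Type*} [NormedAddCommGroup X] [NormedSpace ℂ X]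
  [NormedAddCommGroup W] [InnerProductSpace ℂ W] [FiniteDimensional ℂ W]
  [NormedAddCommGroup Y] [InnerProductSpace ℂ Y] [CompleteSpace Y]

/-- For an injective `T` on a finite-dimensional space, `I - ε T^* T` is a contraction with rate
`1 - ε κ`, for all small `ε > 0`. -/
theorem exists_norm_sub_smul_adjoint_comp_le [CompleteSpace W] (T : W →L[ℂ] Y)
    (hT : Function.Injective T) :
    ∃ κ ε₀ : ℝ, 0 < κ ∧ 0 < ε₀ ∧ ∀ ε : ℝ, 0 < ε → ε ≤ ε₀ → ∀ z : W,
      ‖z - (ε : ℂ) • ContinuousLinearMap.adjoint T (T z)‖ ≤ (1 - ε * κ) * ‖z‖ := by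
  obtain ⟨k, hk, hkT⟩ := (T : W →ₗ[ℂ] Y).exists_antilipschitzWith (LinearMap.ker_eq_bot.2 hT)
  have hk' : (0 : ℝ) < k := hk
  have hlow : ∀ z, ‖z‖ ≤ k * ‖T z‖ := fun z => by
    have := hkT.le_mul_dist z 0
    simpa using this
  -- The first bound on `ε` gives `ε‖T‖² ≤ 1`, so the quadratic term of the expanded square costs at
  -- most half of the gain `2ε‖Tz‖²`. What remains is `1 - ε/k² ≤ (1 - ε/(2k²))²`, whence the factor
  -- 2 in `κ`; `ε ≤ k²` keeps the base of that square nonnegative.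
  refine ⟨1 / (2 * k ^ 2), min (1 / (‖T‖ ^ 2 + 1)) (k ^ 2), by positivity, by positivity,
    fun ε hε hle z => ?_⟩
  have h1 : ε * (‖T‖ ^ 2 + 1) ≤ 1 := by
    have := hle.trans (min_le_left _ _)
    rwa [le_div_iff₀ (by positivity)] at this
  have h2 : ε ≤ k ^ 2 := hle.trans (min_le_right _ _)
  have hfac : ε * (1 / (2 * (k : ℝ) ^ 2)) ≤ 1 / 2 := by
    rw [mul_one_div, div_le_div_iff₀ (by positivity) (by positivity)]
    linarith
  have hTT : ‖ContinuousLinearMap.adjoint T (T z)‖ ≤ ‖T‖ * ‖T z‖ := by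
    simpa using (ContinuousLinearMap.adjoint T).le_opNorm (T z)
  have hexp : ‖z - (ε : ℂ) • ContinuousLinearMap.adjoint T (T z)‖ ^ 2
      = ‖z‖ ^ 2 - 2 * ε * ‖T z‖ ^ 2 + ε ^ 2 * ‖ContinuousLinearMap.adjoint T (T z)‖ ^ 2 := by
    rw [@norm_sub_sq ℂ, inner_smul_right, ContinuousLinearMap.adjoint_inner_right, norm_smul,
      inner_self_eq_norm_sq_to_K, mul_pow]
    have : RCLike.re ((ε : ℂ) * ((‖T z‖ : ℂ)) ^ 2) = ε * ‖T z‖ ^ 2 := by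
      rw [← Complex.ofReal_pow, ← Complex.ofReal_mul]
      exact Complex.ofReal_re _
    have h3 : ‖(ε : ℂ)‖ = ε := by simp [abs_of_pos hε]
    rw [h3]
    erw [this]
    ring
  refine le_of_sq_le_sq ?_ (mul_nonneg (by linarith) (norm_nonneg _))
  rw [hexp, mul_pow]
  have h4 : ‖z‖ ^ 2 ≤ k ^ 2 * ‖T z‖ ^ 2 := by
    rw [← mul_pow]
    exact pow_le_pow_left₀ (norm_nonneg _) (hlow z) 2
  have h5 : ‖ContinuousLinearMap.adjoint T (T z)‖ ^ 2 ≤ ‖T‖ ^ 2 * ‖T z‖ ^ 2 := by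
    rw [← mul_pow]
    exact pow_le_pow_left₀ (norm_nonneg _) hTT 2
  have h6 : ε ^ 2 * ‖ContinuousLinearMap.adjoint T (T z)‖ ^ 2 ≤ ε * ‖T z‖ ^ 2 := by
    have h7 : ε * ‖T‖ ^ 2 ≤ 1 := by nlinarith
    calc _ ≤ ε ^ 2 * (‖T‖ ^ 2 * ‖T z‖ ^ 2) := by gcongr
      _ = ε * ‖T z‖ ^ 2 * (ε * ‖T‖ ^ 2) := by ring
      _ ≤ ε * ‖T z‖ ^ 2 * 1 := by gcongr
      _ = _ := mul_one _
  have h8 : ε * (1 / k ^ 2) * ‖z‖ ^ 2 ≤ ε * ‖T z‖ ^ 2 := by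
    rw [mul_assoc]
    gcongr
    rw [one_div_mul_eq_div, div_le_iff₀ (by positivity)]
    linarith
  have h9 : ε * (1 / (2 * (k : ℝ) ^ 2)) = ε * (1 / k ^ 2) / 2 := by field_simp
  rw [h9]
  nlinarith [mul_nonneg (sq_nonneg (ε * (1 / (k : ℝ) ^ 2))) (sq_nonneg ‖z‖)]

/-- An equivalent norm in which a power stable operator is a strict contraction. -/
theorem exists_seminorm_of_power_stable (Φ : X →L[ℂ] X) {M θ : ℝ} (hθ : 0 < θ) (hθ1 : θ < 1)
    (h : ∀ n : ℕ, ‖Φ ^ n‖ ≤ M * θ ^ n) :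
    ∃ (N : X → ℝ) (ρ a : ℝ), 0 < ρ ∧ ρ < 1 ∧ 0 < a ∧ (∀ x, ‖x‖ ≤ N x) ∧ (∀ x, N x ≤ a * ‖x‖) ∧
      (∀ x y, N (x + y) ≤ N x + N y) ∧ ∀ x, N (Φ x) ≤ ρ * N x := by
  -- Giving up half of the decay exponent lets the spare factor `ρ^m` swallow `M`, so that `‖Φ^m‖ ≤
  -- ρ^m` with no constant. The requirement `m ≥ 1` keeps the term `‖x‖` in the sum defining `N`.
  set ρ := Real.sqrt θ with hρdef
  have hρ : 0 < ρ := Real.sqrt_pos.2 hθ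
  have hρ1 : ρ < 1 := by rw [hρdef, Real.sqrt_lt' one_pos]; simpa using hθ1
  have hsq : ρ ^ 2 = θ := Real.sq_sqrt hθ.le
  have hlim : Tendsto (fun n : ℕ => M * ρ ^ n) atTop (𝓝 (M * 0)) :=
    (tendsto_pow_atTop_nhds_zero_of_lt_one hρ.le hρ1).const_mul M
  rw [mul_zero] at hlim
  obtain ⟨m, hm1, hm⟩ :=
    ((hlim.eventually (gt_mem_nhds one_pos)).and (eventually_ge_atTop 1)).exists
  have hΦm : ‖Φ ^ m‖ ≤ ρ ^ m := by
    refine (h m).trans ?_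
    rw [← hsq, ← pow_mul, two_mul, pow_add, ← mul_assoc]
    exact (mul_le_mul_of_nonneg_right hm1.le (by positivity)).trans (one_mul _).le
  refine ⟨fun x => ∑ i ∈ Finset.range m, (ρ⁻¹) ^ i * ‖(Φ ^ i) x‖, ρ,
    (∑ i ∈ Finset.range m, (ρ⁻¹) ^ i * ‖Φ ^ i‖) + 1, hρ, hρ1, by positivity, fun x => ?_,
    fun x => ?_, fun x y => ?_, fun x => ?_⟩
  · refine le_trans (le_of_eq ?_) (Finset.single_le_sum (f := fun i => (ρ⁻¹) ^ i * ‖(Φ ^ i) x‖)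
      (fun i _ => by positivity) (Finset.mem_range.2 hm))
    simp
  · rw [add_mul, Finset.sum_mul]
    refine le_trans (Finset.sum_le_sum fun i _ => ?_) (le_add_of_nonneg_right (by positivity))
    rw [mul_assoc]
    gcongr
    exact (Φ ^ i).le_opNorm x
  · rw [← Finset.sum_add_distrib]
    refine Finset.sum_le_sum fun i _ => ?_
    rw [map_add, ← mul_add]
    gcongr
    exact norm_add_le _ _
  · have hstep : ∀ i : ℕ, (ρ⁻¹) ^ i * ‖(Φ ^ i) (Φ x)‖
        = ρ * ((ρ⁻¹) ^ (i + 1) * ‖(Φ ^ (i + 1)) x‖) := fun i => by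
      rw [pow_succ Φ, mul_apply_eq_comp, pow_succ]
      field_simp
    simp only [hstep, ← Finset.mul_sum]
    refine mul_le_mul_of_nonneg_left ?_ hρ.le
    -- Applying `Φ` shifts the sum by one index: the term `‖x‖` leaves and `ρ^{-m}‖Φ^m x‖ ≤ ‖x‖`
    -- enters, so the sum does not grow beyond the factor `ρ`.
    have hsum := Finset.sum_range_succ' (fun i => (ρ⁻¹) ^ i * ‖(Φ ^ i) x‖) m
    rw [Finset.sum_range_succ] at hsum
    have hlast : (ρ⁻¹) ^ m * ‖(Φ ^ m) x‖ ≤ ‖x‖ := by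
      calc _ ≤ (ρ⁻¹) ^ m * (ρ ^ m * ‖x‖) := by
            gcongr
            exact (Φ ^ m).le_of_opNorm_le hΦm x
        _ = ‖x‖ := by rw [← mul_assoc, ← mul_pow, inv_mul_cancel₀ hρ.ne', one_pow, one_mul]
    simp only [pow_zero, one_mul, one_apply_eq_self] at hsum
    linarith

/-- The interconnection of a power stable system with a slow integrator is exponentially stable
for small gains. -/
theorem exists_gain_bound [CompleteSpace W] (Φ : X →L[ℂ] X) {M θ : ℝ} (hθ : 0 < θ) (hθ1 : θ < 1)
    (hΦ : ∀ n : ℕ, ‖Φ ^ n‖ ≤ M * θ ^ n) (T : W →L[ℂ] Y) (hT : Function.Injective T)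
    (C : X →L[ℂ] Y) (E : Y →L[ℂ] X) :
    ∃ ε₀ : ℝ, 0 < ε₀ ∧ ∀ ε : ℝ, 0 < ε → ε ≤ ε₀ → ∃ c α : ℝ, 0 < c ∧ 0 < α ∧
      ∀ (ξ : ℕ → X) (ζ : ℕ → W),
        (∀ n, ξ (n + 1) = Φ (ξ n) + (ε : ℂ) • E (C (ξ n) + (ε : ℂ) • T (ζ n))) →
        (∀ n, ζ (n + 1) = ζ n - ContinuousLinearMap.adjoint T (C (ξ n) + (ε : ℂ) • T (ζ n))) →
        ∀ n : ℕ, ‖ξ n‖ + ‖ζ n‖ ≤ c * Real.exp (-α * n) * (‖ξ 0‖ + ‖ζ 0‖) := by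
  obtain ⟨κ, ε₁, hκ, hε₁, hcontr⟩ := exists_norm_sub_smul_adjoint_comp_le T hT
  obtain ⟨N, ρ, a, hρ, hρ1, ha, hN1, hN2, hN3, hN4⟩ :=
    exists_seminorm_of_power_stable Φ hθ hθ1 hΦ
  have hN0 : ∀ x, 0 ≤ N x := fun x => (norm_nonneg x).trans (hN1 x)
  set c₁ := a * (‖E‖ * ‖C‖)
  set c₂ := a * (‖E‖ * ‖T‖)
  set c₃ := ‖T‖ * ‖C‖
  -- This is the weight of `N ξ` in the Lyapunov function `‖ζ‖ + b N ξ`. It is so large that the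
  -- order-one coupling `c₃` uses only a quarter of the contraction margin `1 - ρ`.
  set b := 4 * c₃ / (1 - ρ) + 1 with hb
  have hρ' : 0 < 1 - ρ := by linarith
  have hc₁ : 0 ≤ c₁ := by positivity
  have hc₂ : 0 ≤ c₂ := by positivity
  have hc₃ : 0 ≤ c₃ := by positivity
  have hb1 : 1 ≤ b := le_add_of_nonneg_left (by positivity)
  have hb0 : 0 < b := by linarith
  have hbc : c₃ ≤ b * ((1 - ρ) / 4) := by
    rw [hb, add_mul, div_mul_div_comm]
    have : 4 * c₃ * (1 - ρ) / ((1 - ρ) * 4) = c₃ := by field_simp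
    rw [this]
    linarith
  -- The second bound lets the self-coupling `ε c₁` of `ξ` use another quarter of the margin; the
  -- third gives `b ε² c₂ ≤ εκ/2`, half of the contraction of `ζ`.
  refine ⟨min ε₁ (min ((1 - ρ) / (4 * (c₁ + 1))) (min (κ / (2 * (c₂ * b + 1))) (1 / κ))),
    by positivity, fun ε hε hle => ?_⟩
  simp only [le_min_iff] at hle
  obtain ⟨hle1, hle2, hle3, hle4⟩ := hle
  rw [le_div_iff₀ (by positivity)] at hle2 hle3 hle4
  -- The two entries are the factors left for `ζ` and for `ξ` after the couplings are paid for.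
  set θ' := max (1 - ε * κ / 2) ((1 + ρ) / 2) with hθ'
  have hθ'0 : 0 < θ' := lt_max_of_lt_right (by linarith)
  have hθ'1 : θ' < 1 := max_lt (by nlinarith) (by linarith)
  refine ⟨a * b + 1, -Real.log θ', by positivity, neg_pos.2 (Real.log_neg hθ'0 hθ'1),
    fun ξ ζ hξ hζ n => ?_⟩
  have hεn : ‖(ε : ℂ)‖ = ε := by simp [abs_of_pos hε]
  have hNstep : ∀ n, N (ξ (n + 1)) ≤ (ρ + ε * c₁) * N (ξ n) + ε ^ 2 * c₂ * ‖ζ n‖ := by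
    intro n
    rw [hξ n]
    have h1 : ‖(ε : ℂ) • E (C (ξ n) + (ε : ℂ) • T (ζ n))‖
        ≤ ε * (‖E‖ * (‖C‖ * N (ξ n) + ε * (‖T‖ * ‖ζ n‖))) := by
      rw [norm_smul, hεn]
      gcongr
      refine E.le_of_opNorm_le_of_le le_rfl ((norm_add_le _ _).trans (add_le_add ?_ ?_))
      · exact C.le_of_opNorm_le_of_le le_rfl (hN1 _)
      · rw [norm_smul, hεn]
        gcongr
        exact T.le_opNorm _
    calc _ ≤ ρ * N (ξ n) + a * (ε * (‖E‖ * (‖C‖ * N (ξ n) + ε * (‖T‖ * ‖ζ n‖)))) :=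
          (hN3 _ _).trans (add_le_add (hN4 _) ((hN2 _).trans (by gcongr)))
      _ = _ := by simp only [c₁, c₂]; ring
  have hζstep : ∀ n, ‖ζ (n + 1)‖ ≤ (1 - ε * κ) * ‖ζ n‖ + c₃ * N (ξ n) := by
    intro n
    have h1 : ζ (n + 1) = (ζ n - (ε : ℂ) • ContinuousLinearMap.adjoint T (T (ζ n)))
        - ContinuousLinearMap.adjoint T (C (ξ n)) := by
      rw [hζ n, map_add, map_smul]
      abel
    rw [h1]
    refine (norm_sub_le _ _).trans (add_le_add (hcontr ε hε hle1 _) ?_)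
    rw [mul_assoc]
    exact (ContinuousLinearMap.adjoint T).le_of_opNorm_le_of_le (by simp)
      (C.le_of_opNorm_le_of_le le_rfl (hN1 _))
  have hV : ∀ n, ‖ζ (n + 1)‖ + b * N (ξ (n + 1)) ≤ θ' * (‖ζ n‖ + b * N (ξ n)) := by
    intro n
    have h1 : (1 - ε * κ) + b * (ε ^ 2 * c₂) ≤ θ' :=
      le_trans (by nlinarith) (le_max_left _ _)
    have h2 : c₃ + b * (ρ + ε * c₁) ≤ θ' * b := by
      have h3 : ε * c₁ ≤ (1 - ρ) / 4 := by nlinarith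
      calc _ ≤ b * ((1 - ρ) / 4) + b * (ρ + (1 - ρ) / 4) := by gcongr
        _ = (1 + ρ) / 2 * b := by ring
        _ ≤ _ := by gcongr; exact le_max_right _ _
    calc _ ≤ ((1 - ε * κ) * ‖ζ n‖ + c₃ * N (ξ n))
          + b * ((ρ + ε * c₁) * N (ξ n) + ε ^ 2 * c₂ * ‖ζ n‖) := by
          gcongr
          · exact hζstep n
          · exact hNstep n
      _ = ((1 - ε * κ) + b * (ε ^ 2 * c₂)) * ‖ζ n‖ + (c₃ + b * (ρ + ε * c₁)) * N (ξ n) := by ring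
      _ ≤ θ' * ‖ζ n‖ + θ' * b * N (ξ n) := by
          gcongr
          exact hN0 _
      _ = _ := by ring
  have hVn : ∀ n : ℕ, ‖ζ n‖ + b * N (ξ n) ≤ θ' ^ n * (‖ζ 0‖ + b * N (ξ 0)) := by
    intro n
    induction n with
    | zero => simp
    | succ n ih =>
      refine (hV n).trans ?_
      rw [pow_succ', mul_assoc]
      gcongr
  have hexp : Real.exp (-(-Real.log θ') * n) = θ' ^ n := by
    rw [neg_neg, mul_comm, Real.exp_nat_mul, Real.exp_log hθ'0]
  rw [hexp]
  calc ‖ξ n‖ + ‖ζ n‖ ≤ ‖ζ n‖ + b * N (ξ n) := by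
        have := hN1 (ξ n)
        have := le_mul_of_one_le_left (hN0 (ξ n)) hb1
        linarith
    _ ≤ θ' ^ n * (‖ζ 0‖ + b * N (ξ 0)) := hVn n
    _ ≤ θ' ^ n * ((a * b + 1) * (‖ξ 0‖ + ‖ζ 0‖)) := by
        gcongr
        have h1 : b * N (ξ 0) ≤ b * (a * ‖ξ 0‖) := by
          gcongr
          exact hN2 _
        have h2 : 0 ≤ a * b * ‖ζ 0‖ := by positivity
        nlinarith [norm_nonneg (ξ 0)]
    _ = _ := by ring

end DiscreteStability

/-! ### Passing between single periods and the half-line. -/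

/-- Integrability over every period gives integrability on bounded intervals. -/
theorem intervalIntegrable_zero_of_periods {X : Type*} [NormedAddCommGroup X] {τ : ℝ}
    (hτ : 0 < τ) {f : ℝ → X}
    (hf : ∀ n : ℕ, Integrable (fun s => f ((n : ℝ) * τ + s)) (periodMeasure τ))
    {T : ℝ} (hT : 0 ≤ T) : IntervalIntegrable f volume 0 T := by
  have hstep : ∀ n : ℕ, IntervalIntegrable f volume ((n : ℝ) * τ) (((n + 1 : ℕ) : ℝ) * τ) := by
    intro n
    have h1 : IntervalIntegrable (fun s => f ((n : ℝ) * τ + s)) volume 0 τ :=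
      (intervalIntegrable_iff_integrableOn_Ioc_of_le hτ.le).2 (hf n)
    have h2 := (IntervalIntegrable.comp_add_left_iff (f := f) (a := (n : ℝ) * τ)
      (b := ((n + 1 : ℕ) : ℝ) * τ) (c := (n : ℝ) * τ)
      (by finiteness)).1
    simpa [add_mul] using h2 (by simpa [add_mul] using h1)
  obtain ⟨n, hn⟩ := exists_nat_ge (T / τ)
  have h := IntervalIntegrable.trans_iterate (a := fun n : ℕ => (n : ℝ) * τ) (n := n)
    fun k _ => hstep k
  simp only [CharP.cast_eq_zero, zero_mul] at h
  exact h.mono_set (uIcc_subset_uIcc_left (mem_uIcc_of_le hT ((div_le_iff₀ hτ).1 hn)))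

theorem integral_norm_sq_eq_norm_sq {E : Type*} [NormedAddCommGroup E] {α : Type*}
    [MeasurableSpace α] {μ : Measure α} (f : Lp E 2 μ) : ∫ t, ‖f t‖ ^ 2 ∂μ = ‖f‖ ^ 2 := by
  rw [Lp.norm_def, (Lp.memLp f).eLpNorm_eq_integral_rpow_norm (by norm_num) (by norm_num)]
  have h0 : 0 ≤ ∫ t, ‖f t‖ ^ (2 : ℝ) ∂μ := integral_nonneg fun t => by positivity
  rw [ENNReal.toReal_ofReal (by positivity)]
  simp only [ENNReal.toReal_ofNat]
  rw [← Real.rpow_natCast (_ ^ _) 2, ← Real.rpow_mul h0]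
  norm_num

/-! ### The evolution over one period and the associated bounded operators. -/

namespace PeriodicSystem

variable {τ : ℝ} {X U₀ Ud₀ Y₀ : Type*}
  [NormedAddCommGroup X] [NormedSpace ℂ X]
  [NormedAddCommGroup U₀] [NormedSpace ℂ U₀]
  [NormedAddCommGroup Ud₀] [NormedSpace ℂ Ud₀]
  [NormedAddCommGroup Y₀] [NormedSpace ℂ Y₀]
  {V : Type*} [NormedAddCommGroup V] [NormedSpace ℂ V]

theorem op_add_nat_mul (S : PeriodicSystem τ X U₀ Ud₀ Y₀) (n : ℕ) {s t : ℝ} (h : s ≤ t) :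
    S.evol.op ((n : ℝ) * τ + t) ((n : ℝ) * τ + s) = S.evol.op t s := by
  induction n with
  | zero => simp
  | succ n ih =>
    rw [← ih, ← S.evol_periodic _ _ (by linarith : (n : ℝ) * τ + s ≤ (n : ℝ) * τ + t)]
    push_cast
    ring_nf

theorem pow_op (S : PeriodicSystem τ X U₀ Ud₀ Y₀) (hτ : 0 < τ) (n : ℕ) :
    S.evol.op τ 0 ^ n = S.evol.op ((n : ℝ) * τ) 0 := by
  induction n with
  | zero => simp [S.evol.op_self, ContinuousLinearMap.one_def]
  | succ n ih =>
    have hn : 0 ≤ (n : ℝ) * τ := by positivity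
    have h := S.op_add_nat_mul n hτ.le
    rw [add_zero] at h
    rw [pow_succ', ih, ← h, ContinuousLinearMap.mul_def,
      S.evol.op_comp 0 ((n : ℝ) * τ) ((n : ℝ) * τ + τ) hn (by linarith)]
    push_cast
    ring_nf

/-- Sampling the exponential estimate at `nτ` gives the geometric bound, with `θ = e^{-ωτ}`, that
`exists_gain_bound` requires. -/
theorem exists_norm_pow_op_le (S : PeriodicSystem τ X U₀ Ud₀ Y₀) (hτ : 0 < τ)
    (hS : S.evol.IsExpStable) :
    ∃ M θ : ℝ, 0 < θ ∧ θ < 1 ∧ ∀ n : ℕ, ‖S.evol.op τ 0 ^ n‖ ≤ M * θ ^ n := by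
  obtain ⟨M, ω, hM, hω, h⟩ := hS
  refine ⟨M, Real.exp (-ω * τ), Real.exp_pos _, Real.exp_lt_one_iff.2 (by nlinarith),
    fun n => ?_⟩
  rw [S.pow_op hτ]
  refine (h 0 _ (by positivity)).trans (le_of_eq ?_)
  rw [← Real.exp_nat_mul]
  ring_nf

/-- Restarting the mild solution at `nτ`. -/
theorem mild_shift [CompleteSpace X] (S : PeriodicSystem τ X U₀ Ud₀ Y₀) (hτ : 0 < τ)
    {f : ℝ → X} (hf : ∀ T, 0 ≤ T → IntervalIntegrable f volume 0 T) (x₀ : X) (n : ℕ)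
    {t : ℝ} (ht : 0 ≤ t) :
    S.evol.op ((n : ℝ) * τ + t) 0 x₀
        + ∫ s in (0 : ℝ)..((n : ℝ) * τ + t), S.evol.op ((n : ℝ) * τ + t) s (f s)
      = S.evol.op t 0 (S.evol.op ((n : ℝ) * τ) 0 x₀
          + ∫ s in (0 : ℝ)..((n : ℝ) * τ), S.evol.op ((n : ℝ) * τ) s (f s))
        + ∫ s in (0 : ℝ)..t, S.evol.op t s (f ((n : ℝ) * τ + s)) := by
  set a := (n : ℝ) * τ with ha
  have ha0 : 0 ≤ a := by positivity
  have hop : S.evol.op (a + t) a = S.evol.op t 0 := by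
    have := S.op_add_nat_mul n ht
    rwa [add_zero] at this
  have hint : ∀ T, 0 ≤ T →
      IntervalIntegrable (fun s => S.evol.op T s (f s)) volume 0 T := fun T hT =>
    (intervalIntegrable_iff_integrableOn_Ioc_of_le hT).2 (S.evol.integrable_right T
      ((intervalIntegrable_iff_integrableOn_Ioc_of_le hT).1 (hf T hT)))
  have h1 : S.evol.op (a + t) 0 x₀ = S.evol.op t 0 (S.evol.op a 0 x₀) := by
    rw [← S.evol.op_comp 0 a (a + t) ha0 (by linarith), hop]
    rfl
  have hT := hint (a + t) (by linarith)
  have hleft : IntervalIntegrable (fun s => S.evol.op (a + t) s (f s)) volume 0 a :=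
    hT.mono_set (uIcc_subset_uIcc_left (mem_uIcc_of_le ha0 (by linarith)))
  have hright : IntervalIntegrable (fun s => S.evol.op (a + t) s (f s)) volume a (a + t) :=
    hT.mono_set (uIcc_subset_uIcc_right (mem_uIcc_of_le ha0 (by linarith)))
  -- The cocycle law `U(a+t,s) = U(a+t,a) U(a,s)` and periodicity let `U(t,0)` come out of the
  -- integral over the past.
  have h2 : ∫ s in (0 : ℝ)..a, S.evol.op (a + t) s (f s)
      = S.evol.op t 0 (∫ s in (0 : ℝ)..a, S.evol.op a s (f s)) := by
    rw [← ContinuousLinearMap.intervalIntegral_comp_comm _ (hint a ha0)]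
    refine intervalIntegral.integral_congr fun s hs => ?_
    rw [uIcc_of_le ha0] at hs
    rw [← hop, ← S.evol.op_comp s a (a + t) hs.2 (by linarith)]
    rfl
  have h3 : ∫ s in a..(a + t), S.evol.op (a + t) s (f s)
      = ∫ s in (0 : ℝ)..t, S.evol.op t s (f (a + s)) := by
    have h4 := intervalIntegral.integral_comp_add_left (a := 0) (b := t)
      (fun s => S.evol.op (a + t) s (f s)) a
    rw [add_zero] at h4
    rw [← h4]
    refine intervalIntegral.integral_congr fun s hs => ?_
    rw [uIcc_of_le ht] at hs
    rw [ha, S.op_add_nat_mul n hs.2]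
  rw [← intervalIntegral.integral_add_adjacent_intervals hleft hright, h1, h2, h3, map_add]
  abel

theorem integrable_input (B : ℝ → V →L[ℂ] X) (hB : IsEssBddOp B) (v : PeriodL2 τ V) :
    Integrable (fun s => B s (v s)) (periodMeasure τ) :=
  (hB.memLp (Lp.memLp v)).integrable (by norm_num)

/-- The bounded operator `v ↦ ∫₀^τ U(τ,s) B(s) v(s) ds`. -/
noncomputable def reachOp [CompleteSpace X] (S : PeriodicSystem τ X U₀ Ud₀ Y₀) (B : ℝ → V →L[ℂ] X)
    (hB : IsEssBddOp B) : PeriodL2 τ V →L[ℂ] X :=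
  LinearMap.mkContinuousOfExistsBound
    { toFun := fun v => ∫ s, S.evol.op τ s (B s (v s)) ∂(periodMeasure τ)
      map_add' := fun v w => by
        rw [← integral_add (S.evol.integrable_right τ (integrable_input B hB v))
          (S.evol.integrable_right τ (integrable_input B hB w))]
        refine integral_congr_ae ?_
        filter_upwards [Lp.coeFn_add v w] with s hs
        rw [hs, Pi.add_apply, map_add, map_add]
      map_smul' := fun c v => by
        rw [RingHom.id_apply, ← integral_smul]
        refine integral_congr_ae ?_
        filter_upwards [Lp.coeFn_smul c v] with s hs
        rw [hs, Pi.smul_apply, map_smul, map_smul] }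
    (by
      obtain ⟨a, ha0, ha⟩ := S.evol.exists_bound τ
      obtain ⟨b, hb0, hb⟩ := hB.exists_bound
      obtain ⟨l, hl0, hl⟩ := integral_norm_le_L2 (E := V) τ
      refine ⟨a * b * l, fun v => ?_⟩
      refine (norm_integral_le_of_norm_le (g := fun s => a * b * ‖v s‖)
        (((Lp.memLp v).integrable (by norm_num)).norm.const_mul _) ?_).trans ?_
      · filter_upwards [ae_restrict_mem measurableSet_Ioc, ae_restrict_of_ae hb] with s hs hbs
        rw [mul_assoc]
        exact (S.evol.op τ s).le_of_opNorm_le_of_le (ha s τ hs.1.le hs.2 le_rfl)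
          ((B s).le_of_opNorm_le hbs _)
      · rw [integral_const_mul, mul_assoc (a * b)]
        exact mul_le_mul_of_nonneg_left (hl v) (by positivity))

theorem reachOp_apply [CompleteSpace X] (S : PeriodicSystem τ X U₀ Ud₀ Y₀) (B : ℝ → V →L[ℂ] X)
    (hB : IsEssBddOp B) (v : PeriodL2 τ V) :
    S.reachOp B hB v = ∫ s, S.evol.op τ s (B s (v s)) ∂(periodMeasure τ) := rfl

theorem memLp_observe [CompleteSpace X] (S : PeriodicSystem τ X U₀ Ud₀ Y₀) (x : X) :
    MemLp (fun t => S.C t (S.evol.op t 0 x)) 2 (periodMeasure τ) := by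
  refine S.C_bdd.memLp ?_
  obtain ⟨a, ha0, ha⟩ := S.evol.exists_bound τ
  refine MemLp.of_bound (ContinuousOn.aestronglyMeasurable
    ((S.evol.continuousOn_left 0 x).mono fun t ht => ht.1.le) measurableSet_Ioc) (a * ‖x‖) ?_
  filter_upwards [ae_restrict_mem measurableSet_Ioc] with t ht
  exact (S.evol.op t 0).le_of_opNorm_le (ha 0 t le_rfl ht.1.le ht.2) _

/-- The bounded operator `x ↦ C(·) U(·,0) x` from `X` to `L²(0,τ;Y₀)`. -/
noncomputable def observeOp [CompleteSpace X] (S : PeriodicSystem τ X U₀ Ud₀ Y₀) : X →L[ℂ] PeriodL2 τ Y₀ :=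
  LinearMap.mkContinuousOfExistsBound
    { toFun := fun x => (S.memLp_observe x).toLp fun t => S.C t (S.evol.op t 0 x)
      map_add' := fun x y => by
        rw [← MemLp.toLp_add]
        exact MemLp.toLp_congr _ _ (Eventually.of_forall fun t => by simp)
      map_smul' := fun c x => by
        rw [RingHom.id_apply, ← MemLp.toLp_const_smul]
        exact MemLp.toLp_congr _ _ (Eventually.of_forall fun t => by simp) }
    (by
      obtain ⟨a, ha0, ha⟩ := S.evol.exists_bound τ
      obtain ⟨c, hc0, hc⟩ := S.C_bdd.exists_bound
      refine ⟨measureUnivNNReal (periodMeasure τ) ^ (2 : ℝ≥0∞).toReal⁻¹ * (c * a),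
        fun x => ?_⟩
      refine (Lp.norm_le_of_ae_bound (C := c * (a * ‖x‖)) (by positivity) ?_).trans
        (le_of_eq (by ring))
      filter_upwards [ae_restrict_of_ae hc, (S.memLp_observe x).coeFn_toLp,
        ae_restrict_mem measurableSet_Ioc] with t hct ht' ht
      simp only [LinearMap.coe_mk, AddHom.coe_mk]
      rw [ht']
      exact (S.C t).le_of_opNorm_le_of_le hct
        ((S.evol.op t 0).le_of_opNorm_le (ha 0 t le_rfl ht.1.le ht.2) _))

theorem coeFn_observeOp [CompleteSpace X] (S : PeriodicSystem τ X U₀ Ud₀ Y₀) (x : X) :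
    S.observeOp x =ᵐ[periodMeasure τ] fun t => S.C t (S.evol.op t 0 x) :=
  (S.memLp_observe x).coeFn_toLp

theorem coeFn_steadyOp [CompleteSpace X] (S : PeriodicSystem τ X U₀ Ud₀ Y₀)
    (B : ℝ → V →L[ℂ] X) (hB : IsEssBddOp B) (v : PeriodL2 τ V) :
    S.steadyOp B hB v =ᵐ[periodMeasure τ] S.steadyFun fun s => B s (v s) :=
  (S.memLp_steadyFun (integrable_input B hB v)).coeFn_toLp

theorem coeFn_mulOp (D : ℝ → V →L[ℂ] Y₀) (hD : IsEssBddOp D) (v : PeriodL2 τ V) :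
    mulOp τ D hD v =ᵐ[periodMeasure τ] fun t => D t (v t) :=
  (hD.memLp (Lp.memLp v)).coeFn_toLp

end PeriodicSystem

/-! ### Periodic signals and their `L²` classes. -/

theorem IsPeriodicL2.finset_sum_smul {E : Type*} [NormedAddCommGroup E] [NormedSpace ℂ E]
    {τ : ℝ} {q : ℕ} {w : Fin q → ℝ → E} (hw : ∀ k, IsPeriodicL2 τ (w k)) (v : Fin q → ℂ) :
    IsPeriodicL2 τ fun t => ∑ k, v k • w k t where
  periodic t := by simp [(hw _).periodic t]
  memLp := memLp_finsetSum _ fun k _ => (hw k).memLp.const_smul (v k)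

theorem IsPeriodicL2.toLp_sum_smul {E : Type*} [NormedAddCommGroup E] [NormedSpace ℂ E]
    {τ : ℝ} {q : ℕ} {w : Fin q → ℝ → E} (hw : ∀ k, IsPeriodicL2 τ (w k)) (v : Fin q → ℂ) :
    (IsPeriodicL2.finset_sum_smul hw v).memLp.toLp (fun t => ∑ k, v k • w k t)
      = ∑ k, v k • (hw k).memLp.toLp (w k) := by
  refine Lp.ext ?_
  have h1 : ∀ k, ∀ᵐ t ∂(periodMeasure τ),
      (v k • (hw k).memLp.toLp (w k) : PeriodL2 τ E) t = v k • w k t := fun k => by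
    filter_upwards [Lp.coeFn_smul (v k) ((hw k).memLp.toLp (w k)), (hw k).memLp.coeFn_toLp]
      with t h2 h3
    rw [h2, Pi.smul_apply, h3]
  filter_upwards [(IsPeriodicL2.finset_sum_smul hw v).memLp.coeFn_toLp,
    Lp.coeFn_finsetSum Finset.univ fun k => v k • (hw k).memLp.toLp (w k),
    ae_all_iff.2 h1] with t h2 h3 h4
  rw [h2, h3, Finset.sum_apply]
  exact Finset.sum_congr rfl fun k _ => (h4 k).symm

theorem IsPeriodicL2.zero {E : Type*} [NormedAddCommGroup E] (τ : ℝ) :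
    IsPeriodicL2 τ (fun _ => (0 : E)) :=
  ⟨fun _ => rfl, MemLp.zero⟩

theorem Function.Periodic.nat_mul_add {α : Type*} {f : ℝ → α} {τ : ℝ}
    (hf : Function.Periodic f τ) (n : ℕ) (s : ℝ) : f ((n : ℝ) * τ + s) = f s := by
  rw [add_comm]
  exact hf.nat_mul n s

/-- Links the `L²` class of the error on a period with the tracking integral. Integrability is
proved as well, since the integral of a nonintegrable function is zero by convention and a bound on
it alone would be empty. -/
theorem integral_norm_sq_shift_eq {Y₀ : Type*} [NormedAddCommGroup Y₀] {τ : ℝ} (hτ : 0 < τ)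
    {yref y : ℝ → Y₀} (hyref : Function.Periodic yref τ) (n : ℕ) (e : PeriodL2 τ Y₀)
    (he : e =ᵐ[periodMeasure τ] (fun s => y ((n : ℝ) * τ + s) - yref s)) :
    IntervalIntegrable (fun t => ‖y t - yref t‖ ^ 2) volume
        ((n : ℝ) * τ) (((n : ℝ) + 1) * τ) ∧
      ∫ t in ((n : ℝ) * τ)..(((n : ℝ) + 1) * τ), ‖y t - yref t‖ ^ 2 = ‖e‖ ^ 2 := by
  have hae : (fun s => ‖y ((n : ℝ) * τ + s) - yref ((n : ℝ) * τ + s)‖ ^ 2)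
      =ᵐ[periodMeasure τ] fun s => ‖e s‖ ^ 2 := by
    filter_upwards [he] with s hs
    rw [hs, hyref.nat_mul_add]
  have hend : ((n : ℝ) + 1) * τ = (n : ℝ) * τ + τ := by ring
  constructor
  · have h1 : IntervalIntegrable
        (fun s => ‖y ((n : ℝ) * τ + s) - yref ((n : ℝ) * τ + s)‖ ^ 2) volume 0 τ :=
      (intervalIntegrable_iff_integrableOn_Ioc_of_le hτ.le).2
        (((Lp.memLp e).integrable_norm_pow (by norm_num)).congr hae.symm)
    have h2 := (IntervalIntegrable.comp_add_left_iff
      (f := fun t => ‖y t - yref t‖ ^ 2) (a := (n : ℝ) * τ)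
      (b := ((n : ℝ) + 1) * τ) (c := (n : ℝ) * τ) (by finiteness)).1
    exact h2 (by simpa [add_mul] using h1)
  · have h1 := intervalIntegral.integral_comp_add_left (a := 0) (b := τ)
      (fun t => ‖y t - yref t‖ ^ 2) ((n : ℝ) * τ)
    rw [add_zero] at h1
    rw [hend, ← h1, intervalIntegral.integral_of_le hτ.le, integral_congr_ae hae]
    exact integral_norm_sq_eq_norm_sq e

/-! ### The plant sampled at period boundaries. -/

section Plant

variable {τ : ℝ} {X U₀ Ud₀ Y₀ : Type*}
  [NormedAddCommGroup X] [NormedSpace ℂ X]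
  [NormedAddCommGroup U₀] [NormedSpace ℂ U₀]
  [NormedAddCommGroup Ud₀] [NormedSpace ℂ Ud₀]
  [NormedAddCommGroup Y₀] [NormedSpace ℂ Y₀]

/-- `(x, u, y)` is a trajectory of the plant whose input on the `n`-th period is `v n`. -/
structure IsPlantTrajectory (S : PeriodicSystem τ X U₀ Ud₀ Y₀) (d : ℝ → Ud₀) (x₀ : X)
    (v : ℕ → PeriodL2 τ U₀) (x : ℝ → X) (u : ℝ → U₀) (y : ℝ → Y₀) : Prop where
  state : ∀ t, 0 ≤ t → x t = S.evol.op t 0 x₀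
    + ∫ s in (0 : ℝ)..t, S.evol.op t s (S.B s (u s) + S.Bd s (d s))
  output : ∀ t, 0 ≤ t → y t = S.C t (x t) + S.D t (u t)
  input : ∀ n : ℕ, (fun s => u ((n : ℝ) * τ + s)) =ᵐ[periodMeasure τ] v n

theorem IsClosedLoopTrajectory.isPlantTrajectory {Z : Type*} [NormedAddCommGroup Z]
    [NormedSpace ℂ Z] {S : PeriodicSystem τ X U₀ Ud₀ Y₀} {ctrl : FeedbackController τ U₀ Y₀ Z}
    {yref : ℝ → Y₀} {d : ℝ → Ud₀} {x₀ : X} {z₀ : Z} {x : ℝ → X} {u : ℝ → U₀} {y : ℝ → Y₀}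
    {z : ℕ → Z} (h : IsClosedLoopTrajectory S ctrl yref d x₀ z₀ x u y z) :
    IsPlantTrajectory S d x₀ (fun n => ctrl.K (z n)) x u y :=
  ⟨h.state, h.output, h.input⟩

namespace IsPlantTrajectory

variable {S : PeriodicSystem τ X U₀ Ud₀ Y₀} {d : ℝ → Ud₀} {x₀ : X}
  {v : ℕ → PeriodL2 τ U₀} {x : ℝ → X} {u : ℝ → U₀} {y : ℝ → Y₀}

theorem state_zero (h : IsPlantTrajectory S d x₀ v x u y) : x 0 = x₀ := by
  rw [h.state 0 le_rfl, S.evol.op_self]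
  simp

/-- Periodicity of the coefficients and of `d` moves the forcing of the n-th period to the base
period, where it depends only on the classes `v n` and `d`. -/
theorem forcing_ae_eq (h : IsPlantTrajectory S d x₀ v x u y) (hd : IsPeriodicL2 τ d) (n : ℕ) :
    (fun s => S.B ((n : ℝ) * τ + s) (u ((n : ℝ) * τ + s))
        + S.Bd ((n : ℝ) * τ + s) (d ((n : ℝ) * τ + s)))
      =ᵐ[periodMeasure τ] fun s => S.B s (v n s) + S.Bd s (hd.memLp.toLp d s) := by
  filter_upwards [h.input n, hd.memLp.coeFn_toLp] with s h1 h2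
  rw [S.B_periodic.nat_mul_add, S.Bd_periodic.nat_mul_add, hd.periodic.nat_mul_add, h1, h2]

theorem integrable_forcing (h : IsPlantTrajectory S d x₀ v x u y) (hd : IsPeriodicL2 τ d)
    (n : ℕ) : Integrable (fun s => S.B ((n : ℝ) * τ + s) (u ((n : ℝ) * τ + s))
        + S.Bd ((n : ℝ) * τ + s) (d ((n : ℝ) * τ + s))) (periodMeasure τ) :=
  ((PeriodicSystem.integrable_input S.B S.B_bdd (v n)).add
    (PeriodicSystem.integrable_input S.Bd S.Bd_bdd (hd.memLp.toLp d))).congr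
    (h.forcing_ae_eq hd n).symm

variable [CompleteSpace X]

theorem state_add (h : IsPlantTrajectory S d x₀ v x u y) (hτ : 0 < τ) (hd : IsPeriodicL2 τ d)
    (n : ℕ) {t : ℝ} (ht : 0 ≤ t) :
    x ((n : ℝ) * τ + t) = S.evol.op t 0 (x ((n : ℝ) * τ))
      + ∫ s in (0 : ℝ)..t, S.evol.op t s (S.B ((n : ℝ) * τ + s) (u ((n : ℝ) * τ + s))
        + S.Bd ((n : ℝ) * τ + s) (d ((n : ℝ) * τ + s))) := by
  have hn : 0 ≤ (n : ℝ) * τ := by positivity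
  rw [h.state _ (by linarith), h.state _ hn]
  exact S.mild_shift hτ (f := fun s => S.B s (u s) + S.Bd s (d s))
    (fun T hT => intervalIntegrable_zero_of_periods hτ (h.integrable_forcing hd) hT) x₀ n ht

theorem integral_forcing (h : IsPlantTrajectory S d x₀ v x u y) (hd : IsPeriodicL2 τ d)
    (n : ℕ) :
    ∫ s, S.evol.op τ s (S.B ((n : ℝ) * τ + s) (u ((n : ℝ) * τ + s))
        + S.Bd ((n : ℝ) * τ + s) (d ((n : ℝ) * τ + s))) ∂(periodMeasure τ)
      = S.reachOp S.B S.B_bdd (v n) + S.reachOp S.Bd S.Bd_bdd (hd.memLp.toLp d) := by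
  rw [S.reachOp_apply, S.reachOp_apply, ← integral_add
    (S.evol.integrable_right τ (PeriodicSystem.integrable_input S.B S.B_bdd (v n)))
    (S.evol.integrable_right τ
      (PeriodicSystem.integrable_input S.Bd S.Bd_bdd (hd.memLp.toLp d)))]
  refine integral_congr_ae ?_
  filter_upwards [h.forcing_ae_eq hd n] with s hs
  rw [hs, map_add]

theorem state_succ (h : IsPlantTrajectory S d x₀ v x u y) (hτ : 0 < τ) (hd : IsPeriodicL2 τ d)
    (n : ℕ) :
    x (((n + 1 : ℕ) : ℝ) * τ) = S.evol.op τ 0 (x ((n : ℝ) * τ))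
      + (S.reachOp S.B S.B_bdd (v n) + S.reachOp S.Bd S.Bd_bdd (hd.memLp.toLp d)) := by
  rw [← h.integral_forcing hd n, ← intervalIntegral.integral_of_le hτ.le,
    ← h.state_add hτ hd n hτ.le]
  push_cast
  ring_nf

/-- The plant is compared with the periodic solution for the input `v n` and the disturbance. That
solution starts at `(I - Φ)⁻¹ g` and its output is `𝒫 (v n) + 𝒫_d d`; the difference of the two
states evolves freely and is seen through `observeOp`. -/
theorem output_ae_eq (h : IsPlantTrajectory S d x₀ v x u y) (hτ : 0 < τ)
    (hd : IsPeriodicL2 τ d) (n : ℕ) :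
    (fun s => y ((n : ℝ) * τ + s)) =ᵐ[periodMeasure τ]
      (S.observeOp (x ((n : ℝ) * τ) - Ring.inverse (1 - S.evol.op τ 0)
        (S.reachOp S.B S.B_bdd (v n) + S.reachOp S.Bd S.Bd_bdd (hd.memLp.toLp d)))
      + S.P (v n) + S.Pd (hd.memLp.toLp d) : PeriodL2 τ Y₀) := by
  set g := S.reachOp S.B S.B_bdd (v n) + S.reachOp S.Bd S.Bd_bdd (hd.memLp.toLp d)
  set ξ := x ((n : ℝ) * τ) - Ring.inverse (1 - S.evol.op τ 0) g
  have hP : S.P (v n) = S.steadyOp S.B S.B_bdd (v n) + mulOp τ S.D S.D_bdd (v n) := rfl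
  have hPd : S.Pd (hd.memLp.toLp d) = S.steadyOp S.Bd S.Bd_bdd (hd.memLp.toLp d) := rfl
  rw [hP, hPd]
  filter_upwards [h.input n, S.coeFn_observeOp ξ,
    Lp.coeFn_add (S.observeOp ξ + (S.steadyOp S.B S.B_bdd (v n) + mulOp τ S.D S.D_bdd (v n)))
      (S.steadyOp S.Bd S.Bd_bdd (hd.memLp.toLp d)),
    Lp.coeFn_add (S.observeOp ξ) (S.steadyOp S.B S.B_bdd (v n) + mulOp τ S.D S.D_bdd (v n)),
    Lp.coeFn_add (S.steadyOp S.B S.B_bdd (v n)) (mulOp τ S.D S.D_bdd (v n)),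
    S.coeFn_steadyOp S.B S.B_bdd (v n), S.coeFn_steadyOp S.Bd S.Bd_bdd (hd.memLp.toLp d),
    PeriodicSystem.coeFn_mulOp S.D S.D_bdd (v n), ae_restrict_mem measurableSet_Ioc]
    with t hu hobs h1 h2 h3 hB hBd hD ht
  have hnt : 0 ≤ (n : ℝ) * τ + t := add_nonneg (by positivity) ht.1.le
  rw [h1, Pi.add_apply, h2, Pi.add_apply, h3, Pi.add_apply, hobs, hB, hBd, hD,
    h.output _ hnt, h.state_add hτ hd n ht.1.le, S.C_periodic.nat_mul_add,
    S.D_periodic.nat_mul_add, hu]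
  -- By linearity the input and disturbance responses combine into one response to the total
  -- forcing, whose Green part is the free evolution from `(I - Φ)⁻¹ g`.
  have hsteady : S.steadyFun (fun s => S.B s (v n s)) t
      + S.steadyFun (fun s => S.Bd s (hd.memLp.toLp d s)) t
      = S.C t (S.evol.op t 0 (Ring.inverse (1 - S.evol.op τ 0) g))
        + S.C t (∫ s in (0 : ℝ)..t, S.evol.op t s
          (S.B ((n : ℝ) * τ + s) (u ((n : ℝ) * τ + s))
            + S.Bd ((n : ℝ) * τ + s) (d ((n : ℝ) * τ + s)))) := by
    rw [← S.steadyFun_add (PeriodicSystem.integrable_input S.B S.B_bdd (v n))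
      (PeriodicSystem.integrable_input S.Bd S.Bd_bdd (hd.memLp.toLp d)) ht,
      ← S.steadyFun_congr (h.forcing_ae_eq hd n) ht, PeriodicSystem.steadyFun,
      intervalIntegral.integral_of_le hτ.le,
      S.integral_green t (h.integrable_forcing hd n), h.integral_forcing hd n]
  have hreg : ∀ a b c e : Y₀, a + (b + c) + e = a + (b + e) + c := fun a b c e => by abel
  rw [hreg, hsteady]
  simp only [ξ, map_sub, map_add]
  abel

/-- Between sampling instants the state is controlled by the sampled state and input. -/
theorem exists_norm_state_le (S : PeriodicSystem τ X U₀ Ud₀ Y₀) (hτ : 0 < τ) :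
    ∃ c : ℝ, 0 < c ∧ ∀ (x₀ : X) (v : ℕ → PeriodL2 τ U₀) (x : ℝ → X) (u : ℝ → U₀) (y : ℝ → Y₀),
      IsPlantTrajectory S (fun _ => 0) x₀ v x u y → ∀ (n : ℕ) (t : ℝ), 0 ≤ t → t ≤ τ →
        ‖x ((n : ℝ) * τ + t)‖ ≤ c * (‖x ((n : ℝ) * τ)‖ + ‖v n‖) := by
  obtain ⟨a, ha0, ha⟩ := S.evol.exists_bound τ
  obtain ⟨b, hb0, hb⟩ := S.B_bdd.exists_bound
  obtain ⟨l, hl0, hl⟩ := integral_norm_le_L2 (E := U₀) τ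
  refine ⟨a + a * b * l + 1, by positivity, fun x₀ v x u y h n t ht htτ => ?_⟩
  have hsub : periodMeasure t ≤ periodMeasure τ :=
    Measure.restrict_mono (Ioc_subset_Ioc_right htτ) le_rfl
  have hv : Integrable (v n) (periodMeasure τ) := (Lp.memLp (v n)).integrable (by norm_num)
  rw [h.state_add hτ (IsPeriodicL2.zero τ) n ht, intervalIntegral.integral_of_le ht]
  have h1 : ‖∫ s, S.evol.op t s (S.B ((n : ℝ) * τ + s) (u ((n : ℝ) * τ + s))
      + S.Bd ((n : ℝ) * τ + s) 0) ∂(periodMeasure t)‖ ≤ a * b * (l * ‖v n‖) := by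
    refine (norm_integral_le_of_norm_le (g := fun s => a * b * ‖v n s‖)
      ((hv.mono_measure hsub).norm.const_mul _) ?_).trans ?_
    · filter_upwards [ae_restrict_mem measurableSet_Ioc, ae_restrict_of_ae hb,
        ae_mono hsub (h.input n)] with s hs hbs hus
      rw [map_zero, add_zero, hus, S.B_periodic.nat_mul_add, mul_assoc]
      exact (S.evol.op t s).le_of_opNorm_le_of_le (ha s t hs.1.le hs.2 htτ)
        ((S.B s).le_of_opNorm_le hbs _)
    · rw [integral_const_mul]
      refine mul_le_mul_of_nonneg_left (le_trans ?_ (hl (v n))) (by positivity)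
      exact integral_mono_measure hsub (Eventually.of_forall fun s => norm_nonneg _) hv.norm
  refine (norm_add_le _ _).trans ((add_le_add ((S.evol.op t 0).le_of_opNorm_le
    (ha 0 t le_rfl ht htτ) _) h1).trans ?_)
  have e1 : 0 ≤ a * ‖v n‖ := by positivity
  have e2 : 0 ≤ a * b * l * ‖x ((n : ℝ) * τ)‖ := by positivity
  nlinarith [norm_nonneg (v n), norm_nonneg (x ((n : ℝ) * τ))]

end IsPlantTrajectory

end Plant

/-! ### Existence of closed-loop trajectories, the error formula and the deviation variable. -/

section ClosedLoopTrajectories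

variable {τ : ℝ} {X U₀ Ud₀ Y₀ Z : Type*}
  [NormedAddCommGroup X] [NormedSpace ℂ X] [CompleteSpace X]
  [NormedAddCommGroup U₀] [NormedSpace ℂ U₀]
  [NormedAddCommGroup Ud₀] [NormedSpace ℂ Ud₀]
  [NormedAddCommGroup Y₀] [NormedSpace ℂ Y₀]
  [NormedAddCommGroup Z] [NormedSpace ℂ Z]

/-- The input on a period depends only on the controller state at its start, so the sampled pairs
`(x_n, z_n)` form an explicit recursion that can be run first. The input is then glued from its
pieces, and induction shows that the samples of the resulting mild state are the `x_n`. -/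
theorem exists_isClosedLoopTrajectory (S : PeriodicSystem τ X U₀ Ud₀ Y₀) (hτ : 0 < τ)
    (ctrl : FeedbackController τ U₀ Y₀ Z) {r : ℝ → Y₀} {d : ℝ → Ud₀} (hr : IsPeriodicL2 τ r)
    (hd : IsPeriodicL2 τ d) (x₀ : X) (z₀ : Z) :
    ∃ x u y z, IsClosedLoopTrajectory S ctrl r d x₀ z₀ x u y z := by
  let g : Z → X := fun z => S.reachOp S.B S.B_bdd (ctrl.K z)
    + S.reachOp S.Bd S.Bd_bdd (hd.memLp.toLp d)
  let e : X × Z → PeriodL2 τ Y₀ := fun p =>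
    S.observeOp (p.1 - Ring.inverse (1 - S.evol.op τ 0) (g p.2)) + S.P (ctrl.K p.2)
      + S.Pd (hd.memLp.toLp d) - hr.memLp.toLp r
  let F : X × Z → X × Z := fun p =>
    (S.evol.op τ 0 p.1 + g p.2, ctrl.G₁ p.2 + ctrl.G₂ (e p))
  let p : ℕ → X × Z := fun n => F^[n] (x₀, z₀)
  have hp : ∀ n, p (n + 1) = F (p n) := fun n => Function.iterate_succ_apply' F n _
  -- Each piece lives on `(nτ, (n+1)τ]`, matching the base period `(0, τ]`. For `t ≤ 0` the index is
  -- negative and `toNat` sends it to `0`, which is harmless.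
  let u : ℝ → U₀ := fun t => ctrl.K (p (toIocDiv hτ 0 t).toNat).2 (toIocMod hτ 0 t)
  have hu : ∀ n : ℕ, (fun s => u ((n : ℝ) * τ + s)) =ᵐ[periodMeasure τ] ctrl.K (p n).2 := by
    intro n
    filter_upwards [ae_restrict_mem measurableSet_Ioc] with s hs
    have h1 : toIocDiv hτ 0 ((n : ℝ) * τ + s) = n :=
      toIocDiv_eq_of_sub_zsmul_mem_Ioc hτ (by simpa using hs)
    have h2 : toIocMod hτ 0 ((n : ℝ) * τ + s) = s :=
      (toIocMod_eq_iff hτ).2 ⟨by simpa using hs, n, by simp [add_comm]⟩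
    simp only [u, h1, h2, Int.toNat_natCast]
  let x : ℝ → X := fun t => S.evol.op t 0 x₀
    + ∫ s in (0 : ℝ)..t, S.evol.op t s (S.B s (u s) + S.Bd s (d s))
  have hplant : IsPlantTrajectory S d x₀ (fun n => ctrl.K (p n).2) x u
      (fun t => S.C t (x t) + S.D t (u t)) :=
    ⟨fun _ _ => rfl, fun _ _ => rfl, hu⟩
  have hx : ∀ n : ℕ, x ((n : ℝ) * τ) = (p n).1 := by
    intro n
    induction n with
    | zero => simpa [p] using hplant.state_zero
    | succ n ih => rw [hplant.state_succ hτ hd n, ih, hp]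
  refine ⟨x, u, fun t => S.C t (x t) + S.D t (u t), fun n => (p n).2, hplant.state,
    hplant.output, hu, rfl, fun n => ⟨e (p n), ?_, by rw [hp]⟩⟩
  have hy := hplant.output_ae_eq hτ hd n
  rw [hx n] at hy
  filter_upwards [hy, hr.memLp.coeFn_toLp, Lp.coeFn_sub
    (S.observeOp ((p n).1 - Ring.inverse (1 - S.evol.op τ 0) (g (p n).2))
      + S.P (ctrl.K (p n).2) + S.Pd (hd.memLp.toLp d)) (hr.memLp.toLp r)] with s h1 h2 h3
  rw [h1, ← h2]
  exact h3

/-- The regulation error on the `n`-th period. -/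
theorem IsClosedLoopTrajectory.exists_error {S : PeriodicSystem τ X U₀ Ud₀ Y₀} (hτ : 0 < τ)
    {ctrl : FeedbackController τ U₀ Y₀ Z} {r : ℝ → Y₀} {d : ℝ → Ud₀} (hr : IsPeriodicL2 τ r)
    (hd : IsPeriodicL2 τ d) {x₀ : X} {z₀ : Z} {x : ℝ → X} {u : ℝ → U₀} {y : ℝ → Y₀} {z : ℕ → Z}
    (h : IsClosedLoopTrajectory S ctrl r d x₀ z₀ x u y z) (n : ℕ) :
    ∃ e : PeriodL2 τ Y₀, e =ᵐ[periodMeasure τ] (fun s => y ((n : ℝ) * τ + s) - r s) ∧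
      z (n + 1) = ctrl.G₁ (z n) + ctrl.G₂ e ∧
      e = S.observeOp (x ((n : ℝ) * τ) - Ring.inverse (1 - S.evol.op τ 0)
          (S.reachOp S.B S.B_bdd (ctrl.K (z n)) + S.reachOp S.Bd S.Bd_bdd (hd.memLp.toLp d)))
        + S.P (ctrl.K (z n)) + S.Pd (hd.memLp.toLp d) - hr.memLp.toLp r := by
  obtain ⟨e, he, hz⟩ := h.ctrl_succ n
  refine ⟨e, he, hz, Lp.ext ?_⟩
  have hy := h.isPlantTrajectory.output_ae_eq hτ hd n
  filter_upwards [he, hy, hr.memLp.coeFn_toLp, Lp.coeFn_sub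
    (S.observeOp (x ((n : ℝ) * τ) - Ring.inverse (1 - S.evol.op τ 0)
      (S.reachOp S.B S.B_bdd (ctrl.K (z n)) + S.reachOp S.Bd S.Bd_bdd (hd.memLp.toLp d)))
      + S.P (ctrl.K (z n)) + S.Pd (hd.memLp.toLp d)) (hr.memLp.toLp r)] with s h1 h2 h3 h4
  rw [h1, h2, h4, ← h3]
  rfl

/-- The deviation of the plant state from its steady state for the periodic input `v` and
disturbance `d`. -/
noncomputable def stateDeviation (S : PeriodicSystem τ X U₀ Ud₀ Y₀) (x : X) (v : PeriodL2 τ U₀)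
    (d : PeriodL2 τ Ud₀) : X :=
  x - Ring.inverse (1 - S.evol.op τ 0) (S.reachOp S.B S.B_bdd v + S.reachOp S.Bd S.Bd_bdd d)

/-- The state and its deviation differ by a bounded linear function of `(v, d)`, so one constant
serves both directions. -/
theorem exists_norm_stateDeviation_le (S : PeriodicSystem τ X U₀ Ud₀ Y₀) :
    ∃ c : ℝ, 1 ≤ c ∧ ∀ x v d, ‖stateDeviation S x v d‖ ≤ c * (‖x‖ + ‖v‖ + ‖d‖) ∧
      ‖x‖ ≤ c * (‖stateDeviation S x v d‖ + ‖v‖ + ‖d‖) := by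
  set R := Ring.inverse (1 - S.evol.op τ 0)
  set b := S.reachOp S.B S.B_bdd
  set b' := S.reachOp S.Bd S.Bd_bdd
  refine ⟨1 + ‖R‖ * (‖b‖ + ‖b'‖), le_add_of_nonneg_right (by positivity), fun x v d => ?_⟩
  have h1 : ‖R (b v + b' d)‖ ≤ ‖R‖ * (‖b‖ + ‖b'‖) * (‖v‖ + ‖d‖) := by
    rw [mul_assoc]
    refine R.le_of_opNorm_le_of_le le_rfl ((norm_add_le _ _).trans ?_)
    have h2 := b.le_opNorm v
    have h3 := b'.le_opNorm d
    have h4 : 0 ≤ ‖b‖ * ‖d‖ := by positivity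
    have h5 : 0 ≤ ‖b'‖ * ‖v‖ := by positivity
    linarith
  have h6 : stateDeviation S x v d = x - R (b v + b' d) := rfl
  have h7 : 0 ≤ ‖R‖ * (‖b‖ + ‖b'‖) := by positivity
  have h8 : 0 ≤ ‖v‖ + ‖d‖ := by positivity
  constructor
  · rw [h6]
    refine (norm_sub_le _ _).trans ?_
    nlinarith [mul_nonneg h7 (norm_nonneg x)]
  · have h9 : x = stateDeviation S x v d + R (b v + b' d) := by rw [h6]; abel
    have h10 : ‖x‖ ≤ ‖stateDeviation S x v d‖ + ‖R (b v + b' d)‖ := by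
      conv_lhs => rw [h9]
      exact norm_add_le _ _
    nlinarith [mul_nonneg h7 (norm_nonneg (stateDeviation S x v d))]

end ClosedLoopTrajectories

/-! ### The integrating controller: decay, stability and tracking. -/

section SlowIntegrator

variable {τ : ℝ} {X U₀ Ud₀ Y₀ W : Type*}
  [NormedAddCommGroup X] [NormedSpace ℂ X] [CompleteSpace X]
  [NormedAddCommGroup U₀] [NormedSpace ℂ U₀]
  [NormedAddCommGroup Ud₀] [NormedSpace ℂ Ud₀]
  [NormedAddCommGroup Y₀] [InnerProductSpace ℂ Y₀] [CompleteSpace Y₀]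
  [NormedAddCommGroup W] [InnerProductSpace ℂ W] [CompleteSpace W]

/-- The integrating controller `G₁ = I`, `G₂ = -(𝒫 L)^*`, `K = ε L`. -/
noncomputable def integralController (S : PeriodicSystem τ X U₀ Ud₀ Y₀)
    (L : W →L[ℂ] PeriodL2 τ U₀) (ε : ℝ) : FeedbackController τ U₀ Y₀ W where
  G₁ := ContinuousLinearMap.id ℂ _
  G₂ := -ContinuousLinearMap.adjoint (S.P.comp L)
  K := (ε : ℂ) • L

/-- If the steady-state gain `𝒫 L` is injective and the gain `ε` is small, then the closed loop
approaches its steady state exponentially, and so does the regulation error approach zero. -/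
theorem exists_deviation_decay [FiniteDimensional ℂ W] (S : PeriodicSystem τ X U₀ Ud₀ Y₀)
    (hτ : 0 < τ) (hS : S.evol.IsExpStable) (L : W →L[ℂ] PeriodL2 τ U₀)
    (hL : Function.Injective (S.P.comp L)) :
    ∃ ε₀ : ℝ, 0 < ε₀ ∧ ∀ ε : ℝ, 0 < ε → ε ≤ ε₀ → ∃ c α : ℝ, 0 < c ∧ 0 < α ∧
      ∀ (r : ℝ → Y₀) (d : ℝ → Ud₀) (hr : IsPeriodicL2 τ r) (hd : IsPeriodicL2 τ d) (zs : W),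
        S.P (L zs) + S.Pd (hd.memLp.toLp d) = hr.memLp.toLp r →
        ∀ (x₀ : X) (z₀ : W) (x : ℝ → X) (u : ℝ → U₀) (y : ℝ → Y₀) (z : ℕ → W),
        IsClosedLoopTrajectory S (integralController S L ε) r d x₀ z₀ x u y z → ∀ n : ℕ,
          (‖stateDeviation S (x ((n : ℝ) * τ)) ((ε : ℂ) • L (z n)) (hd.memLp.toLp d)‖
              + ‖z n - (ε : ℂ)⁻¹ • zs‖
            ≤ c * Real.exp (-α * n)
              * (‖stateDeviation S x₀ ((ε : ℂ) • L z₀) (hd.memLp.toLp d)‖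
                + ‖z₀ - (ε : ℂ)⁻¹ • zs‖)) ∧
          ∃ e : PeriodL2 τ Y₀,
            e =ᵐ[periodMeasure τ] (fun s => y ((n : ℝ) * τ + s) - r s) ∧
            ‖e‖ ≤ c * Real.exp (-α * n)
              * (‖stateDeviation S x₀ ((ε : ℂ) • L z₀) (hd.memLp.toLp d)‖
                + ‖z₀ - (ε : ℂ)⁻¹ • zs‖) := by
  obtain ⟨M, θ, hθ, hθ1, hΦ⟩ := S.exists_norm_pow_op_le hτ hS
  set Φ := S.evol.op τ 0 with hΦdef
  set R := Ring.inverse (1 - Φ) with hR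
  set T := S.P.comp L with hT
  -- This says that `R g` is a fixed point of `x ↦ Φ x + g`, the sampled form of periodicity.
  have hΦR : ∀ g : X, Φ (R g) = R g - g := fun g => by
    have h1 := DFunLike.congr_fun (Ring.mul_inverse_cancel _ (S.isUnit_one_sub hτ hS)) g
    simp only [mul_apply_eq_comp, sub_apply, one_apply_eq_self] at h1
    exact eq_sub_iff_add_eq'.2 (sub_eq_iff_eq_add.1 h1).symm
  -- The steady state moves by `R (g_n - g_{n+1})`. The disturbance cancels there, and `z_n -
  -- z_{n+1} = T^* e_n` leaves `ε E e_n`.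
  let E : PeriodL2 τ Y₀ →L[ℂ] X :=
    R.comp ((S.reachOp S.B S.B_bdd).comp (L.comp (ContinuousLinearMap.adjoint T)))
  obtain ⟨ε₀, hε₀, hmain⟩ := exists_gain_bound Φ hθ hθ1 hΦ T hL S.observeOp E
  refine ⟨ε₀, hε₀, fun ε hε hle => ?_⟩
  obtain ⟨c, α, hc, hα, hdecay⟩ := hmain ε hε hle
  -- The factor `k` bounds `‖e‖` by `‖ξ‖ + ‖ζ‖`; its summand `1` lets the same constant bound the
  -- deviations themselves.
  set k := 1 + ‖S.observeOp‖ + ε * ‖T‖ with hk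
  have hk1 : 1 ≤ k := by rw [hk, add_assoc]; exact le_add_of_nonneg_right (by positivity)
  refine ⟨k * c, α, by positivity, hα, fun r d hr hd zs hzs x₀ z₀ x u y z h => ?_⟩
  have hεne : (ε : ℂ) ≠ 0 := by exact_mod_cast hε.ne'
  set dL := hd.memLp.toLp d
  set ξ : ℕ → X := fun n => stateDeviation S (x ((n : ℝ) * τ)) ((ε : ℂ) • L (z n)) dL with hξ
  -- Since `K = ε L`, the controller state that produces the input `L zs` is `zs / ε`.
  set ζ : ℕ → W := fun n => z n - (ε : ℂ)⁻¹ • zs with hζ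
  have herr : ∀ n : ℕ, ∃ e : PeriodL2 τ Y₀,
      e =ᵐ[periodMeasure τ] (fun s => y ((n : ℝ) * τ + s) - r s) ∧
      z (n + 1) = z n - ContinuousLinearMap.adjoint T e ∧
      e = S.observeOp (ξ n) + (ε : ℂ) • T (ζ n) := by
    intro n
    obtain ⟨e, he1, he2, he3⟩ := h.exists_error hτ hr hd n
    refine ⟨e, he1, by rw [he2, sub_eq_add_neg]; rfl, ?_⟩
    have h1 : (ε : ℂ) • T (ζ n) = S.P ((ε : ℂ) • L (z n)) - S.P (L zs) := by
      rw [hζ, map_sub, map_smul T, smul_sub, smul_inv_smul₀ hεne, map_smul]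
      rfl
    rw [he3, h1, ← hzs]
    have h2 : (integralController S L ε).K (z n) = (ε : ℂ) • L (z n) := rfl
    rw [h2]
    simp only [hξ, stateDeviation]
    abel
  have hζs : ∀ n, ζ (n + 1) = ζ n
      - ContinuousLinearMap.adjoint T (S.observeOp (ξ n) + (ε : ℂ) • T (ζ n)) := by
    intro n
    obtain ⟨e, -, he2, he3⟩ := herr n
    rw [← he3]
    simp only [hζ, he2]
    abel
  have hξs : ∀ n, ξ (n + 1) = Φ (ξ n)
      + (ε : ℂ) • E (S.observeOp (ξ n) + (ε : ℂ) • T (ζ n)) := by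
    intro n
    obtain ⟨e, -, he2, he3⟩ := herr n
    rw [← he3]
    have h1 := h.isPlantTrajectory.state_succ hτ hd n
    have h2 : (integralController S L ε).K (z n) = (ε : ℂ) • L (z n) := rfl
    simp only [h2] at h1
    have h3 : E e = R (S.reachOp S.B S.B_bdd (L (ContinuousLinearMap.adjoint T e))) := rfl
    simp only [hξ, stateDeviation]
    rw [h1, he2, h3]
    simp only [map_sub, map_add, map_smul, ← hR, ← hΦdef, hΦR, smul_sub]
    abel
  have hx0 : x 0 = x₀ := h.isPlantTrajectory.state_zero
  have hξ0 : ξ 0 = stateDeviation S x₀ ((ε : ℂ) • L z₀) dL := by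
    simp [hξ, hx0, h.ctrl_zero]
  have hζ0 : ζ 0 = z₀ - (ε : ℂ)⁻¹ • zs := by simp [hζ, h.ctrl_zero]
  intro n
  have hn := hdecay ξ ζ hξs hζs n
  rw [← hξ0, ← hζ0]
  have hsum : k * (‖ξ n‖ + ‖ζ n‖)
      ≤ k * c * Real.exp (-α * n) * (‖ξ 0‖ + ‖ζ 0‖) := by
    calc _ ≤ k * (c * Real.exp (-α * n) * (‖ξ 0‖ + ‖ζ 0‖)) := by gcongr
      _ = _ := by ring
  refine ⟨(le_mul_of_one_le_left (by positivity) hk1).trans hsum, ?_⟩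
  obtain ⟨e, he1, -, he3⟩ := herr n
  refine ⟨e, he1, le_trans ?_ hsum⟩
  rw [he3]
  refine (norm_add_le _ _).trans ?_
  rw [norm_smul]
  have h1 := S.observeOp.le_opNorm (ξ n)
  have h2 : ‖(ε : ℂ)‖ * ‖T (ζ n)‖ ≤ ε * (‖T‖ * ‖ζ n‖) := by
    rw [Complex.norm_of_nonneg hε.le]
    gcongr
    exact T.le_opNorm _
  have h3 : 0 ≤ ‖S.observeOp‖ * ‖ζ n‖ := by positivity
  have h4 : 0 ≤ ε * ‖T‖ * ‖ξ n‖ := by positivity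
  rw [hk]
  nlinarith [norm_nonneg (ξ n), norm_nonneg (ζ n)]

/-- Decay of the deviation and of `z` at the sampling times gives decay of the sampled state by the
bounded change of variables. Between samples the state is controlled by the last sample and input,
which turns the rate `α` per step into the rate `α / τ` in time. -/
theorem isExpStableClosedLoop_of_decay (S : PeriodicSystem τ X U₀ Ud₀ Y₀)
    (hτ : 0 < τ) (L : W →L[ℂ] PeriodL2 τ U₀) {ε c α : ℝ} (hc : 0 < c) (hα : 0 < α)
    (hdecay : ∀ (x₀ : X) (z₀ : W) (x : ℝ → X) (u : ℝ → U₀) (y : ℝ → Y₀) (z : ℕ → W),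
        IsClosedLoopTrajectory S (integralController S L ε) (fun _ => 0) (fun _ => 0)
          x₀ z₀ x u y z → ∀ n : ℕ,
          ‖stateDeviation S (x ((n : ℝ) * τ)) ((ε : ℂ) • L (z n)) 0‖ + ‖z n‖
            ≤ c * Real.exp (-α * n)
              * (‖stateDeviation S x₀ ((ε : ℂ) • L z₀) 0‖ + ‖z₀‖)) :
    IsExpStableClosedLoop S (integralController S L ε) := by
  obtain ⟨a, ha1, ha⟩ := exists_norm_stateDeviation_le S
  obtain ⟨b, hb, hxb⟩ := IsPlantTrajectory.exists_norm_state_le S hτ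
  set l := ‖(ε : ℂ) • L‖
  have hl : ∀ z, ‖(ε : ℂ) • L z‖ ≤ l * ‖z‖ := fun z => ((ε : ℂ) • L).le_opNorm z
  have hl0 : 0 ≤ l := norm_nonneg _
  set m := a * (1 + l) + 1 with hm
  have hm0 : 0 < m := by positivity
  have hinit : ∀ (x₀ : X) (z₀ : W), ‖stateDeviation S x₀ ((ε : ℂ) • L z₀) 0‖ + ‖z₀‖
      ≤ m * (‖x₀‖ + ‖z₀‖) := by
    intro x₀ z₀
    have h1 := (ha x₀ ((ε : ℂ) • L z₀) 0).1
    rw [norm_zero, add_zero] at h1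
    have h2 : a * (‖x₀‖ + ‖(ε : ℂ) • L z₀‖) ≤ a * (‖x₀‖ + l * ‖z₀‖) := by
      gcongr
      exact hl z₀
    have h3 : 0 ≤ a * ‖z₀‖ := by positivity
    have h4 : 0 ≤ a * l * ‖x₀‖ := by positivity
    rw [hm]
    nlinarith [norm_nonneg x₀]
  refine ⟨b * (m + l) * (c * m) * Real.exp α, c * m, α / τ, α, by positivity, by positivity,
    by positivity, hα, fun x₀ z₀ x u y z h => ?_⟩
  have hn : ∀ n : ℕ, ‖stateDeviation S (x ((n : ℝ) * τ)) ((ε : ℂ) • L (z n)) 0‖ + ‖z n‖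
      ≤ c * m * Real.exp (-α * n) * (‖x₀‖ + ‖z₀‖) := fun n => by
    refine (hdecay x₀ z₀ x u y z h n).trans ?_
    calc _ ≤ c * Real.exp (-α * n) * (m * (‖x₀‖ + ‖z₀‖)) := by
          gcongr
          exact hinit x₀ z₀
      _ = _ := by ring
  refine ⟨fun t ht => ?_, fun n => le_trans (le_add_of_nonneg_left (norm_nonneg _)) (hn n)⟩
  set n := ⌊t / τ⌋₊
  have hnt : (n : ℝ) * τ ≤ t := (le_div_iff₀ hτ).1 (Nat.floor_le (by positivity))
  have htn : t ≤ ((n : ℝ) + 1) * τ := ((div_lt_iff₀ hτ).1 (Nat.lt_floor_add_one _)).le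
  have h1 := hxb x₀ _ x u y h.isPlantTrajectory n (t - n * τ) (by linarith) (by linarith)
  rw [add_sub_cancel] at h1
  have h2 := (ha (x ((n : ℝ) * τ)) ((ε : ℂ) • L (z n)) 0).2
  rw [norm_zero, add_zero] at h2
  set D := ‖stateDeviation S (x ((n : ℝ) * τ)) ((ε : ℂ) • L (z n)) 0‖
  have hK : (integralController S L ε).K (z n) = (ε : ℂ) • L (z n) := rfl
  simp only [hK] at h1
  have h3 : ‖x ((n : ℝ) * τ)‖ + ‖(ε : ℂ) • L (z n)‖ ≤ (m + l) * (D + ‖z n‖) := by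
    have h4 : a * (D + ‖(ε : ℂ) • L (z n)‖) ≤ a * (D + l * ‖z n‖) := by
      gcongr
      exact hl _
    have h5 := hl (z n)
    have h6 : 0 ≤ a * ‖z n‖ := by positivity
    have h7 : 0 ≤ a * l * D := by positivity
    have h8 : 0 ≤ l * D := by positivity
    have h9 : 0 ≤ D := norm_nonneg _
    rw [hm]
    nlinarith [norm_nonneg (z n)]
  -- Here `n` is the floor of `t / τ`; rounding down costs at most one step, hence the factor `e^α`.
  have hexp : Real.exp (-α * n) ≤ Real.exp α * Real.exp (-(α / τ) * t) := by
    rw [← Real.exp_add]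
    refine Real.exp_le_exp.2 ?_
    have : α / τ * t ≤ α * (n + 1) := by
      rw [div_mul_eq_mul_div, div_le_iff₀ hτ, mul_assoc]
      gcongr
    linarith
  calc ‖x t‖ ≤ b * ((m + l) * (D + ‖z n‖)) := h1.trans (by gcongr)
    _ ≤ b * ((m + l) * (c * m * Real.exp (-α * n) * (‖x₀‖ + ‖z₀‖))) := by
        gcongr
        exact hn n
    _ ≤ b * ((m + l) * (c * m * (Real.exp α * Real.exp (-(α / τ) * t)) * (‖x₀‖ + ‖z₀‖))) := by
        gcongr
    _ = _ := by ring

/-- The integrating controller solves the output regulation problem if the input needed to track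
the reference and to reject each disturbance is in the range of `L`. -/
theorem exists_solvesErrorFeedbackORP_integralController [FiniteDimensional ℂ W]
    (S : PeriodicSystem τ X U₀ Ud₀ Y₀) (hτ : 0 < τ) (hS : S.evol.IsExpStable)
    (L : W →L[ℂ] PeriodL2 τ U₀) (hL : Function.Injective (S.P.comp L))
    {q : ℕ} (yref : ℝ → Y₀) (hyref : IsPeriodicL2 τ yref)
    (w : Fin q → ℝ → Ud₀) (hw : ∀ k, IsPeriodicL2 τ (w k)) (z₀s : W) (zs : Fin q → W)
    (hz₀s : S.P (L z₀s) = hyref.memLp.toLp yref)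
    (hzs : ∀ k, S.P (L (zs k)) = S.Pd ((hw k).memLp.toLp (w k))) :
    ∃ ε₀ : ℝ, 0 < ε₀ ∧ ∀ ε : ℝ, 0 < ε → ε ≤ ε₀ →
      SolvesErrorFeedbackORP S (integralController S L ε) yref w := by
  obtain ⟨ε₀, hε₀, hmain⟩ := exists_deviation_decay S hτ hS L hL
  refine ⟨ε₀, hε₀, fun ε hε hle => ?_⟩
  obtain ⟨c, α, hc, hα, hdecay⟩ := hmain ε hε hle
  refine ⟨fun r d hr hd x₀ z₀ => exists_isClosedLoopTrajectory S hτ _ hr hd x₀ z₀, ?_, ?_⟩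
  · refine isExpStableClosedLoop_of_decay S hτ L hc hα fun x₀ z₀ x u y z h n => ?_
    have hd0 : (IsPeriodicL2.zero (E := Ud₀) τ).memLp.toLp (fun _ => 0) = 0 := MemLp.toLp_zero _
    have hr0 : (IsPeriodicL2.zero (E := Y₀) τ).memLp.toLp (fun _ => 0) = 0 := MemLp.toLp_zero _
    have h1 := (hdecay _ _ (IsPeriodicL2.zero τ) (IsPeriodicL2.zero τ) 0
      (by rw [hd0, hr0]; simp) x₀ z₀ x u y z h n).1
    rw [hd0] at h1
    simpa only [smul_zero, sub_zero] using h1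
  · obtain ⟨a, ha1, ha⟩ := exists_norm_stateDeviation_le S
    set l := ‖(ε : ℂ) • L‖
    have hl : ∀ z, ‖(ε : ℂ) • L z‖ ≤ l * ‖z‖ := fun z => ((ε : ℂ) • L).le_opNorm z
    set δ := ∑ k, ‖(hw k).memLp.toLp (w k)‖ with hδ
    set σ := ‖z₀s‖ + ∑ k, ‖zs k‖ with hσ
    have hl0 : 0 ≤ l := norm_nonneg _
    have hδ0 : 0 ≤ δ := Finset.sum_nonneg fun _ _ => norm_nonneg _
    have hσ0 : 0 ≤ σ := by positivity
    -- Here `δ` and `σ` bound the disturbance and the target `zs` linearly in `v`. The factor `ε⁻¹`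
    -- comes from the shift `zs / ε`; it is harmless, as the constants may depend on `ε`.
    set m := a * (1 + l + δ) + 1 + ε⁻¹ * σ with hm
    have hm0 : 0 < m := by positivity
    refine ⟨2 * (c * m), α, by positivity, hα, fun x₀ z₀ v x u y z h n => ?_⟩
    set dL := (IsPeriodicL2.finset_sum_smul hw v).memLp.toLp (fun t => ∑ k, v k • w k t)
      with hdL
    have hdsum : dL = ∑ k, v k • (hw k).memLp.toLp (w k) := IsPeriodicL2.toLp_sum_smul hw v
    have hdn : ‖dL‖ ≤ δ * ‖v‖ := by
      rw [hdsum, hδ, Finset.sum_mul]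
      refine norm_sum_le_of_le _ fun k _ => ?_
      rw [norm_smul, mul_comm]
      gcongr
      exact PiLp.norm_apply_le v k
    -- The disturbance inputs enter with a minus sign because they must cancel `𝒫_d d`, while `𝒫 u^k
    -- = 𝒫_d w^k`.
    have hss : S.P (L (z₀s - ∑ k, v k • zs k)) + S.Pd dL = hyref.memLp.toLp yref := by
      rw [hdsum, map_sub, map_sub, hz₀s]
      simp only [map_sum, map_smul, hzs]
      abel
    have hsn : ‖z₀s - ∑ k, v k • zs k‖ ≤ σ * (‖v‖ + 1) := by
      refine (norm_sub_le _ _).trans ?_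
      have h1 : ‖∑ k, v k • zs k‖ ≤ (∑ k, ‖zs k‖) * ‖v‖ := by
        rw [Finset.sum_mul]
        refine norm_sum_le_of_le _ fun k _ => ?_
        rw [norm_smul, mul_comm]
        gcongr
        exact PiLp.norm_apply_le v k
      have h2 : 0 ≤ ∑ k, ‖zs k‖ := Finset.sum_nonneg fun _ _ => norm_nonneg _
      rw [hσ]
      nlinarith [norm_nonneg v, norm_nonneg z₀s, mul_nonneg (norm_nonneg z₀s) (norm_nonneg v)]
    obtain ⟨-, e, he, hen⟩ := hdecay _ _ hyref (IsPeriodicL2.finset_sum_smul hw v)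
      (z₀s - ∑ k, v k • zs k) hss x₀ z₀ x u y z h n
    obtain ⟨hint, heq⟩ := integral_norm_sq_shift_eq hτ hyref.periodic n e he
    refine ⟨hint, ?_⟩
    rw [heq]
    have hinit : ‖stateDeviation S x₀ ((ε : ℂ) • L z₀) dL‖
        + ‖z₀ - (ε : ℂ)⁻¹ • (z₀s - ∑ k, v k • zs k)‖ ≤ m * (‖x₀‖ + ‖z₀‖ + ‖v‖ + 1) := by
      have h1 : ‖stateDeviation S x₀ ((ε : ℂ) • L z₀) dL‖
          ≤ a * (‖x₀‖ + l * ‖z₀‖ + δ * ‖v‖) := by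
        refine (ha x₀ _ dL).1.trans ?_
        gcongr
        exact hl z₀
      have h2 : ‖z₀ - (ε : ℂ)⁻¹ • (z₀s - ∑ k, v k • zs k)‖
          ≤ ‖z₀‖ + ε⁻¹ * (σ * (‖v‖ + 1)) := by
        refine (norm_sub_le _ _).trans ?_
        rw [norm_smul, norm_inv, Complex.norm_of_nonneg hε.le]
        gcongr
      refine (add_le_add h1 h2).trans ?_
      set N := ‖x₀‖ + ‖z₀‖ + ‖v‖ + 1 with hN
      have hx : ‖x₀‖ ≤ N := by rw [hN]; linarith [norm_nonneg z₀, norm_nonneg v]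
      have hz : ‖z₀‖ ≤ N := by rw [hN]; linarith [norm_nonneg x₀, norm_nonneg v]
      have hv : ‖v‖ ≤ N := by rw [hN]; linarith [norm_nonneg x₀, norm_nonneg z₀]
      have hv1 : ‖v‖ + 1 ≤ N := by rw [hN]; linarith [norm_nonneg x₀, norm_nonneg z₀]
      calc _ ≤ a * (N + l * N + δ * N) + (N + ε⁻¹ * (σ * N)) := by gcongr
        _ = m * N := by rw [hm]; ring
    calc ‖e‖ ^ 2 ≤ (c * Real.exp (-α * n) * (m * (‖x₀‖ + ‖z₀‖ + ‖v‖ + 1))) ^ 2 := by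
          gcongr
          refine hen.trans ?_
          gcongr
      _ = (c * m) ^ 2 * Real.exp (-2 * α * n) * (‖x₀‖ + ‖z₀‖ + ‖v‖ + 1) ^ 2 := by
          have : Real.exp (-2 * α * n) = Real.exp (-α * n) ^ 2 := by
            rw [← Real.exp_nat_mul]
            congr 1
            push_cast
            ring
          rw [this]
          ring
      -- The square of a sum of four terms is at most four times the sum of squares; hence the
      -- factor 2 in `M = 2 c m`.
      _ ≤ (c * m) ^ 2 * Real.exp (-2 * α * n)
          * (4 * (‖x₀‖ ^ 2 + ‖z₀‖ ^ 2 + ‖v‖ ^ 2 + 1)) := by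
          gcongr
          nlinarith [sq_nonneg (‖x₀‖ - ‖z₀‖), sq_nonneg (‖x₀‖ - ‖v‖), sq_nonneg (‖x₀‖ - 1),
            sq_nonneg (‖z₀‖ - ‖v‖), sq_nonneg (‖z₀‖ - 1), sq_nonneg (‖v‖ - 1)]
      _ = _ := by ring

end SlowIntegrator

/-! ### The synthesis operator and the change of basis `Q`. -/

section Synthesis

variable {τ : ℝ} {U₀ : Type*} [NormedAddCommGroup U₀] [NormedSpace ℂ U₀]

theorem synthesisOp_apply {r : ℕ} (u : Fin r → PeriodL2 τ U₀) (z : EuclideanSpace ℂ (Fin r)) :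
    synthesisOp u z = ∑ j, z j • u j := by
  simp [synthesisOp]

theorem synthesisOp_comp_injective {r : ℕ} {F : Type*} [NormedAddCommGroup F] [NormedSpace ℂ F]
    (P : PeriodL2 τ U₀ →L[ℂ] F) (u : Fin r → PeriodL2 τ U₀)
    (h : LinearIndependent ℂ fun j => P (u j)) :
    Function.Injective fun z => P (synthesisOp u z) := by
  intro z z' hzz
  simp only [synthesisOp_apply, map_sum, map_smul] at hzz
  ext j
  have h1 := Fintype.linearIndependent_iff.1 h (fun j => z j - z' j) (by
    simp only [sub_smul, Finset.sum_sub_distrib, hzz, sub_self]) j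
  exact sub_eq_zero.1 h1

theorem exists_synthesisOp_eq {r : ℕ} (u : Fin r → PeriodL2 τ U₀) {f : PeriodL2 τ U₀}
    (hf : f ∈ Submodule.span ℂ (Set.range u)) : ∃ z, synthesisOp u z = f := by
  obtain ⟨c, hc⟩ := (Submodule.mem_span_range_iff_exists_fun ℂ).1 hf
  exact ⟨WithLp.toLp 2 c, by rw [synthesisOp_apply]; exact hc⟩

theorem toEuclideanCLM_bijective {r : ℕ} {Q : Matrix (Fin r) (Fin r) ℂ} (hQ : IsUnit Q) :
    Function.Bijective (Matrix.toEuclideanCLM (𝕜 := ℂ) Q) := by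
  obtain ⟨A, hA⟩ := hQ.map (Matrix.toEuclideanCLM (𝕜 := ℂ) (n := Fin r))
  rw [← hA]
  refine ⟨Function.LeftInverse.injective (g := (↑A⁻¹ : _ →L[ℂ] _)) fun z => ?_,
    Function.RightInverse.surjective (g := (↑A⁻¹ : _ →L[ℂ] _)) fun z => ?_⟩
  · rw [← mul_apply_eq_comp, A.inv_mul, one_apply_eq_self]
  · rw [← mul_apply_eq_comp, A.mul_inv, one_apply_eq_self]

end Synthesis


/-! ### The main theorem. -/

theorem mainTheorem2
    {X U₀ Ud₀ Y₀ : Type*}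
    [NormedAddCommGroup X] [NormedSpace ℂ X] [CompleteSpace X]
    [NormedAddCommGroup U₀] [InnerProductSpace ℂ U₀] [CompleteSpace U₀]
    [NormedAddCommGroup Ud₀] [InnerProductSpace ℂ Ud₀] [CompleteSpace Ud₀]
    [NormedAddCommGroup Y₀] [InnerProductSpace ℂ Y₀] [CompleteSpace Y₀]
    {τ : ℝ} (hτ : 0 < τ)
    (S : PeriodicSystem τ X U₀ Ud₀ Y₀) (hS : S.evol.IsExpStable)
    {q : ℕ} (yref : ℝ → Y₀) (hyref : IsPeriodicL2 τ yref)
    (w : Fin q → ℝ → Ud₀) (hw : ∀ k, IsPeriodicL2 τ (w k))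
    (hne : ¬ (yref =ᵐ[volume] 0) ∨ ∃ k, ¬ (w k =ᵐ[volume] 0))
    (ureg : Fin (q + 1) → PeriodL2 τ U₀)
    (hureg_zero : S.P (ureg 0) = hyref.memLp.toLp yref)
    (hureg_succ : ∀ k : Fin q, S.P (ureg k.succ) = S.Pd ((hw k).memLp.toLp (w k)))
    {r : ℕ} (idx : Fin r → Fin (q + 1))
    (hidx_indep : LinearIndependent ℂ (fun j => ureg (idx j)))
    (hidx_span : Submodule.span ℂ (Set.range fun j => ureg (idx j))
      = Submodule.span ℂ (Set.range ureg))
    (hP_indep : LinearIndependent ℂ (fun j => S.P (ureg (idx j))))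
    (Q : Matrix (Fin r) (Fin r) ℂ) (hQ : IsUnit Q) :
    ∃ εstar : ℝ, 0 < εstar ∧ ∀ ε : ℝ, 0 < ε → ε ≤ εstar →
      SolvesErrorFeedbackORP S
        (regulatorController S (fun j => ureg (idx j)) Q ε) yref w := by
  have hQb := toEuclideanCLM_bijective hQ
  set u : Fin r → PeriodL2 τ U₀ := fun j => ureg (idx j)
  set L := (synthesisOp u).comp (Matrix.toEuclideanCLM (𝕜 := ℂ) Q)
  have hL : Function.Injective (S.P.comp L) :=
    (synthesisOp_comp_injective S.P u hP_indep).comp hQb.1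
  -- The span hypothesis reaches every required input through `K₀`, and surjectivity of `Q` carries
  -- this over to `L = K₀ Q`.
  have hrange : ∀ k, ∃ z, L z = ureg k := fun k => by
    obtain ⟨z, hz⟩ := exists_synthesisOp_eq u
      (hidx_span ▸ Submodule.subset_span (Set.mem_range_self k))
    obtain ⟨z', rfl⟩ := hQb.2 z
    exact ⟨z', hz⟩
  choose zs hzs using hrange
  -- `regulatorController` unfolds to `integralController` for this `L`, so the general result
  -- applies by definitional equality.
  exact exists_solvesErrorFeedbackORP_integralController S hτ hS L hL yref hyref w hw (zs 0)
    (fun k => zs k.succ) (by rw [hzs, hureg_zero]) fun k => by rw [hzs, hureg_succ]
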